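/- Let $q\ge 2$ and let $q'$ be its conjugate exponent, $1/q+1/q'=1$. Let $f:[0,1]\to\mathbb R$ be of class $C^1$ with $f(0)=f(1)=0$ and $f>0$ on $(0,1)$, let $$\lim_{s\to0^+}\frac{f(s)}{s^{q'-1}}=L_0,\qquad \sup_{s\in(0,1]}\frac{f(s)}{s^{q'-1}}=L_+<+\infty,$$ and suppose that for some $k>0$ one has $f(s)\le k(1-s)$ for all $s\in[0,1]$. Consider, for $c\in\mathbb R$, the travelling wave problem (the case $p=q$ of the $(p,q)$-Laplacian) $$(2|v'|^{q-2}v')'-c\,v'+f(v)=0\ \text{ on }\mathbb R,\qquad v(-\infty)=0,\quad v(+\infty)=1. \tag{1}$$ Solutions are classical: $v$ and $2|v'|^{q-2}v'$ are differentiable on $\mathbb R$. Call $c$ admissible if (1) has a nondecreasing solution, and strictly admissible if (1) has a solution with $v'>0$ on all of $\mathbb R$. Then there is a critical speed $c^*$ with $$2^{1/q}L_0^{1/q'}\,q'^{1/q'}\,q^{1/q}\ \le\ c^*\ \le\ 2^{1/q}L_+^{1/q'}\,q'^{1/q'}\,q^{1/q}$$ such that $c$ is admissible if and only if $c\ge c^*$.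 Moreover every $c>c^*$ is strictly admissible, $c^*$ itself is strictly admissible if $q=2$, and for every $q\ge2$ the upper bound $2^{1/q}L_+^{1/q'}q'^{1/q'}q^{1/q}$ is strictly admissible. In particular, if $L_0=L_+$, then $c^*=2^{1/q}L_0^{1/q'}q'^{1/q'}q^{1/q}$. -/

import Mathlib

open Set Filter Topology

noncomputable section

/-- The flux `|s|^(p-2) s + |s|^(q-2) s` of the one-dimensional `(p, q)`-Laplacian. -/
def pqFlux (p q s : ℝ) : ℝ := |s| ^ (p - 2) * s + |s| ^ (q - 2) * s

/-- For `p = q` the flux is `2 |s|^(q-2) s`. -/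
theorem pqFlux_self (q s : ℝ) : pqFlux q q s = 2 * |s| ^ (q - 2) * s := by
  unfold pqFlux; ring

/-- A reaction term of Fisher type: `C¹` on `[0, 1]`, vanishing at `0` and `1` and positive on
`(0, 1)`. Only the values of `f` on `[0, 1]` matter. -/
structure IsFisherReaction (f : ℝ → ℝ) : Prop where
  contDiffOn : ContDiffOn ℝ 1 f (Icc 0 1)
  map_zero : f 0 = 0
  map_one : f 1 = 0
  pos : ∀ s ∈ Ioo (0 : ℝ) 1, 0 < f s

/-- `v` is a monotone (nondecreasing) classical solution on the whole real line of
`(|v'|^(p-2) v' + |v'|^(q-2) v')' - c v' + f(v) = 0`, `v(-∞) = 0`, `v(+∞) = 1`.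
Such a `v` takes its values in `[0, 1]`. -/
structure IsMonotoneFront (p q : ℝ) (f : ℝ → ℝ) (c : ℝ) (v : ℝ → ℝ) : Prop where
  differentiable : Differentiable ℝ v
  differentiable_flux : Differentiable ℝ (fun z => pqFlux p q (deriv v z))
  equation : ∀ z, deriv (fun x => pqFlux p q (deriv v x)) z - c * deriv v z + f (v z) = 0
  tendsto_atBot : Tendsto v atBot (𝓝 0)
  tendsto_atTop : Tendsto v atTop (𝓝 1)
  monotone : Monotone v

/-- A monotone front with `v' > 0` on the whole real line. -/
structure IsStrictFront (p q : ℝ) (f : ℝ → ℝ) (c : ℝ) (v : ℝ → ℝ) : Prop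
    extends IsMonotoneFront p q f c v where
  deriv_pos : ∀ z, 0 < deriv v z

/-- The speed `c` is admissible: there is a monotone front with speed `c`. -/
def IsAdmissible (p q : ℝ) (f : ℝ → ℝ) (c : ℝ) : Prop := ∃ v, IsMonotoneFront p q f c v

/-- The speed `c` is strictly admissible: there is a front of speed `c` with `v' > 0` on `ℝ`. -/
def IsStrictlyAdmissible (p q : ℝ) (f : ℝ → ℝ) (c : ℝ) : Prop := ∃ v, IsStrictFront p q f c v

/-- The bound `2^(1/q) L^(1/q') q'^(1/q') q^(1/q)`. -/
def speedBound (q q' L : ℝ) : ℝ :=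
  2 ^ (1 / q) * L ^ (1 / q') * q' ^ (1 / q') * q ^ (1 / q)

end

/-!
For a nondecreasing front `v` write the flux `w = 2 (v')^(q-1)` as a function of the state `s = v`,
and put `y = w^(q')`. The equation of the front becomes the first order problem
`y' = q' (c y^(1/q) - g(s))` on `[0, 1]` with `g = 2^(q'-1) f` and `y(0) = y(1) = 0`. Its right-hand
side is nondecreasing in `y` when `c ≥ 0`, so comparison holds backwards from `s = 1`
(`le_of_hasDerivAt_le_of_lt`), although `y^(1/q)` is not Lipschitz at `0`. Hence for every `c ≥ 0`
there is exactly one solution with `y(1) = 0`, the phase curve of speed `c`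
(`exists_isPhaseCurve`); it is positive on `(0, 1)` and depends on `c` in a monotone and continuous
way (`IsPhaseCurve.le_of_speed_le`, `IsPhaseCurve.le_add_mul`). Therefore the speeds with `y(0) = 0`
form a closed half-line `[cs, ∞)` with `cs > 0` (`exists_critical_speed`).

These are the admissible speeds. Fronts have positive speed (`IsMonotoneFront.speed_pos`), and along
a front the square of `w^(q') - y(v)` is nondecreasing and takes arbitrarily small values near `+∞`,
so it vanishes, and `y(0) = 0` (`IsMonotoneFront.phaseCurve_zero`). Conversely, a phase curve with
`y(0) = 0` gives a front by solving `v' = y(v)^(1/q) / 2^(q'-1)`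
(`IsPhaseCurve.exists_isMonotoneFront`). By the linear bound on `f` at `1` the value `1` is not
reached in finite time. The front is strict if moreover `y^(1/q) = O(s)` at `0`.

The bounds on `cs` come from linear functions `w = x s`, since `speedBound q q' L` is the minimum
over `x > 0` of `x + 2^(q'-1) L / x^(q'-1)`. At `c = speedBound q q' Lp` the line through the minimum
point lies above the phase curve (`IsPhaseCurve.le_linear_of_speedBound`). If `c` is less than
`speedBound q q' L` for some `L < L₀`, then `w / s` grows logarithmically as `s → 0`, which
contradicts `w ≤ c s` (`IsPhaseCurve.speedBound_le`).

Strictness is immediate for `q = 2`, where `y^(1/q) = w ≤ c s`. For `q > 2` it suffices that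
`w ≤ a s` for some `a < c` (`IsPhaseCurve.exists_rpow_le_mul`): as `f` is `C¹`, power barriers
improve this to `w = O(s^(q-1))`. Above `cs` one takes `a = cs`, by comparison with the critical
phase curve; at `c = speedBound q q' Lp` one takes `a = c / q`.
-/

/-! ### Comparison and existence for scalar equations solved backwards in time -/

theorem hasDerivAt_max_zero_sq (x : ℝ) :
    HasDerivAt (fun t : ℝ => max t 0 ^ 2) (2 * max x 0) x := by
  rcases lt_trichotomy x 0 with hx | rfl | hx
  · rw [max_eq_right hx.le, mul_zero]
    refine (hasDerivAt_const x (0 : ℝ)).congr_of_eventuallyEq ?_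
    filter_upwards [Iio_mem_nhds hx] with t ht
    rw [max_eq_right (le_of_lt ht)]; norm_num
  · rw [max_self, mul_zero, hasDerivAt_iff_isLittleO]
    have h2 : (fun t : ℝ => t ^ 2) =o[𝓝 0] fun t : ℝ => t := by
      simpa using! Asymptotics.isLittleO_pow_id (𝕜 := ℝ) (n := 2) one_lt_two
    refine (Asymptotics.IsBigO.of_bound 1 (Eventually.of_forall fun t => ?_)).trans_isLittleO
      (by simpa using h2)
    rcases le_total t 0 with ht | ht
    · simp [max_eq_right ht, sq_nonneg]
    · simp [max_eq_left ht]
  · have h := (hasDerivAt_id x).pow 2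
    rw [max_eq_left hx.le]
    refine (h.congr_deriv (by simp)).congr_of_eventuallyEq ?_
    filter_upwards [Ioi_mem_nhds hx] with t ht
    simp [max_eq_left (le_of_lt (mem_Ioi.1 ht))]

/-- Backward comparison: if `y - z` is nondecreasing wherever it is positive, then `y ≤ z`
propagates from the right end point to the whole interval. -/
theorem le_of_hasDerivAt_le_of_lt {a b : ℝ} {y z y' z' : ℝ → ℝ}
    (hy : ContinuousOn y (Icc a b)) (hz : ContinuousOn z (Icc a b))
    (hy' : ∀ s ∈ Ioo a b, HasDerivAt y (y' s) s) (hz' : ∀ s ∈ Ioo a b, HasDerivAt z (z' s) s)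
    (h : ∀ s ∈ Ioo a b, z s < y s → z' s ≤ y' s) (hb : y b ≤ z b) :
    ∀ s ∈ Icc a b, y s ≤ z s := by
  intro s hs
  have hmono : MonotoneOn (fun t => max (y t - z t) 0 ^ 2) (Icc a b) := by
    refine monotoneOn_of_hasDerivWithinAt_nonneg (convex_Icc a b)
      (f' := fun t => 2 * max (y t - z t) 0 * (y' t - z' t)) ?_ ?_ ?_
    · exact ((hy.sub hz).sup continuousOn_const).pow 2
    · intro t ht
      rw [interior_Icc] at ht
      exact ((hasDerivAt_max_zero_sq _).comp t ((hy' t ht).sub (hz' t ht))).hasDerivWithinAt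
    · intro t ht
      rw [interior_Icc] at ht
      rcases le_or_gt (y t - z t) 0 with h0 | h0
      · simp [max_eq_right h0]
      · have := h t ht (by linarith)
        exact mul_nonneg (by positivity) (by linarith)
  have h1 := hmono hs (right_mem_Icc.2 (hs.1.trans hs.2)) hs.2
  simp only [max_eq_right (sub_nonpos.2 hb)] at h1
  by_contra! hlt
  rw [max_eq_left (by linarith)] at h1
  nlinarith

/-- The Cauchy–Lipschitz theorem on the whole of `[0, 1]`, from the terminal value `y(1) = 0`, for
a bounded right-hand side. -/
theorem exists_backward_solution_of_lipschitz {ψ G : ℝ → ℝ} {B : ℝ} {K : NNReal}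
    (hψ : LipschitzWith K ψ) (hG : ContinuousOn G (Icc 0 1))
    (hB : ∀ x, ∀ t ∈ Icc (0 : ℝ) 1, |ψ x - G t| ≤ B) :
    ∃ y : ℝ → ℝ, y 1 = 0 ∧
      ∀ s ∈ Icc (0 : ℝ) 1, HasDerivWithinAt y (ψ (y s) - G s) (Icc 0 1) s := by
  have hB0 : 0 ≤ B := (abs_nonneg _).trans (hB 0 0 (by simp))
  have hPL : IsPicardLindelof (fun t x => ψ x - G t) (tmin := 0) (tmax := 1)
      ⟨1, by simp⟩ 0 B.toNNReal 0 B.toNNReal K :=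
    { lipschitzOnWith := fun t _ => by
        refine LipschitzWith.lipschitzOnWith ?_
        refine LipschitzWith.of_dist_le_mul fun x x' => ?_
        rw [dist_sub_right]
        exact hψ.dist_le_mul x x'
      continuousOn := fun x _ => continuousOn_const.sub hG
      norm_le := fun t ht x _ => by
        rw [Real.norm_eq_abs, Real.coe_toNNReal _ hB0]; exact hB x t ht
      mul_max_le := by simp }
  exact hPL.exists_eq_forall_mem_Icc_hasDerivWithinAt₀

/-- Existence of a solution of `y' = ψ(y) - G(s)` on `[0, 1]` with `y(1) = 0`, when `ψ` is the
limit of a decreasing sequence of nondecreasing Lipschitz functions. The solutions of the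
approximate equations increase by comparison, and the integral equation passes to the limit. -/
theorem exists_backward_solution {ψ G : ℝ → ℝ} {B : ℝ} (ψn : ℕ → ℝ → ℝ) (K : ℕ → NNReal)
    (hK : ∀ n, LipschitzWith (K n) (ψn n)) (hmono : ∀ n, Monotone (ψn n))
    (hanti : ∀ x, Antitone fun n => ψn n x)
    (hlim : ∀ (x : ℝ) (u : ℕ → ℝ), Tendsto u atTop (𝓝 x) →
      Tendsto (fun n => ψn n (u n)) atTop (𝓝 (ψ x)))
    (hψ : Continuous ψ) (hG : ContinuousOn G (Icc 0 1))
    (hB : ∀ n x, ∀ t ∈ Icc (0 : ℝ) 1, |ψn n x - G t| ≤ B) :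
    ∃ y : ℝ → ℝ, y 1 = 0 ∧
      ∀ s ∈ Icc (0 : ℝ) 1, HasDerivWithinAt y (ψ (y s) - G s) (Icc 0 1) s := by
  choose y hy1 hy using fun n => exists_backward_solution_of_lipschitz (hK n) hG (hB n)
  have hyc : ∀ n, ContinuousOn (y n) (Icc 0 1) := fun n => HasDerivWithinAt.continuousOn (hy n)
  have hyI : ∀ n, ∀ s ∈ Ioo (0 : ℝ) 1, HasDerivAt (y n) (ψn n (y n s) - G s) s :=
    fun n s hs => (hy n s (Ioo_subset_Icc_self hs)).hasDerivAt (Icc_mem_nhds hs.1 hs.2)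
  have hle : ∀ s ∈ Icc (0 : ℝ) 1, Monotone fun n => y n s := by
    intro s hs n m hnm
    refine le_of_hasDerivAt_le_of_lt (hyc n) (hyc m) (hyI n) (hyI m) (fun t _ hlt => ?_)
      (by rw [hy1, hy1]) s hs
    have h1 := hmono m hlt.le
    have h2 := hanti (y n t) hnm
    dsimp only at h2
    linarith
  have hLip : ∀ n, ∀ s ∈ Icc (0 : ℝ) 1, ∀ t ∈ Icc (0 : ℝ) 1, |y n t - y n s| ≤ B * |t - s| :=
    fun n s hs t ht => (convex_Icc (0 : ℝ) 1).norm_image_sub_le_of_norm_hasDerivWithin_le (hy n)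
      (fun r hr => hB n _ r hr) hs ht
  have hB0 : 0 ≤ B := (abs_nonneg _).trans (hB 0 0 0 (by simp))
  have hbd : ∀ s ∈ Icc (0 : ℝ) 1, BddAbove (range fun n => y n s) := by
    rintro s hs
    refine ⟨B, ?_⟩
    rintro _ ⟨n, rfl⟩
    have h1 := hLip n 1 (by simp) s hs
    rw [hy1, sub_zero, abs_sub_comm, abs_of_nonneg (a := 1 - s) (by linarith [hs.2])] at h1
    have h2 := le_abs_self (y n s)
    have h3 := hs.1
    dsimp only
    nlinarith
  set Y : ℝ → ℝ := fun s => ⨆ n, y n s with hY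
  have hYlim : ∀ s ∈ Icc (0 : ℝ) 1, Tendsto (fun n => y n s) atTop (𝓝 (Y s)) :=
    fun s hs => tendsto_atTop_ciSup (hle s hs) (hbd s hs)
  have hYc : ContinuousOn Y (Icc 0 1) := by
    have : LipschitzOnWith B.toNNReal Y (Icc 0 1) := by
      refine LipschitzOnWith.of_dist_le_mul fun t ht s hs => ?_
      rw [Real.coe_toNNReal _ hB0, Real.dist_eq, Real.dist_eq]
      exact le_of_tendsto ((hYlim t ht).sub (hYlim s hs)).abs
        (Eventually.of_forall fun n => hLip n s hs t ht)
    exact this.continuousOn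
  have hInt : ∀ s ∈ Icc (0 : ℝ) 1, Y s = ODE.picard (fun t x => ψ x - G t) 1 0 Y s := by
    intro s hs
    have hsub : uIcc 1 s ⊆ Icc (0 : ℝ) 1 := uIcc_subset_Icc (by simp) hs
    have h1 : ∀ n, ∫ t in (1 : ℝ)..s, (ψn n (y n t) - G t) = y n s := by
      intro n
      have := ODE.picard_eq_of_hasDerivAt (f := fun t x => ψn n x - G t) (α := y n) (t₀ := 1)
        (t := s) (u := univ)
        (((hK n).continuous.comp continuous_snd).continuousOn.sub
          (hG.comp continuousOn_fst fun p hp => hsub hp.1))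
        (fun t ht => (hy n t (hsub ht)).mono hsub) (mapsTo_univ _ _)
      rwa [ODE.picard_apply, hy1, zero_add] at this
    have h2 : Tendsto (fun n => ∫ t in (1 : ℝ)..s, (ψn n (y n t) - G t)) atTop
        (𝓝 (∫ t in (1 : ℝ)..s, (ψ (Y t) - G t))) := by
      refine intervalIntegral.tendsto_integral_filter_of_dominated_convergence (fun _ => B)
        (Eventually.of_forall fun n => ?_)
        (Eventually.of_forall fun n => Eventually.of_forall fun t ht => ?_)
        intervalIntegrable_const (Eventually.of_forall fun t ht => ?_)
      · refine ContinuousOn.aestronglyMeasurable ?_ measurableSet_uIoc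
        exact (((hK n).continuous.comp_continuousOn (hyc n)).sub hG).mono
          (uIoc_subset_uIcc.trans hsub)
      · exact hB n _ t (hsub (uIoc_subset_uIcc ht))
      · exact (hlim _ _ (hYlim t (hsub (uIoc_subset_uIcc ht)))).sub_const _
    simp only [h1] at h2
    rw [ODE.picard_apply, zero_add]
    exact tendsto_nhds_unique (hYlim s hs) h2
  refine ⟨Y, by rw [hInt 1 (by simp), ODE.picard_apply₀], fun s hs => ?_⟩
  refine (ODE.hasDerivWithinAt_picard_Icc (f := fun t x => ψ x - G t) (t₀ := 1) (u := univ)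
    (by simp) ?_ hYc (fun _ _ => mem_univ _) 0 hs).congr hInt (hInt s hs)
  exact (hψ.comp continuous_snd).continuousOn.sub (hG.comp continuousOn_fst fun p hp => hp.1)

/-! ### Identities between conjugate powers -/

section ConjugatePowers

variable {q q' : ℝ}

theorem rpow_conj_rpow_one_div (hqq' : q.HolderConjugate q') {x : ℝ} (hx : 0 ≤ x) :
    (x ^ q') ^ (1 / q) = x ^ (q' - 1) := by
  rw [← Real.rpow_mul hx]
  congr 1
  have := hqq'.symm.sub_one_mul_conj
  have := hqq'.pos
  field_simp
  linarith

theorem rpow_one_div_conj_rpow_sub_one (hqq' : q.HolderConjugate q') {x : ℝ} (hx : 0 ≤ x) :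
    (x ^ (1 / q')) ^ (q' - 1) = x ^ (1 / q) := by
  rw [← rpow_conj_rpow_one_div hqq' (Real.rpow_nonneg hx _), ← Real.rpow_mul hx,
    one_div_mul_cancel hqq'.symm.ne_zero, Real.rpow_one]

theorem rpow_sub_one_rpow_conj_sub_one (hqq' : q.HolderConjugate q') {x : ℝ} (hx : 0 ≤ x) :
    (x ^ (q - 1)) ^ (q' - 1) = x := by
  rw [← Real.rpow_mul hx]
  have h1 := hqq'.mul_eq_add
  rw [show (q - 1) * (q' - 1) = 1 by linarith, Real.rpow_one]

theorem sub_one_mul_one_div (hqq' : q.HolderConjugate q') : (q' - 1) * (1 / q') = 1 / q := by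
  have h1 := hqq'.symm.sub_one_mul_conj
  have := hqq'.pos
  have := hqq'.symm.pos
  field_simp
  linarith

end ConjugatePowers

/-! ### Phase curves -/

/-- A phase curve of speed `c`: a nonnegative solution on `[0, 1]` of
`y' = q' (c y^(1/q) - g(s))` with `y(1) = 0`. For `g = 2^(q'-1) f` and a front `v` of speed `c`,
the flux `w = 2 (v')^(q-1)`, seen as a function of `s = v`, is `w = y^(1/q')`. The value `y(0)` is
left free: a front exists precisely when it is `0`. -/
structure IsPhaseCurve (q q' c : ℝ) (g y : ℝ → ℝ) : Prop where
  hasDerivWithinAt : ∀ s ∈ Icc (0 : ℝ) 1,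
    HasDerivWithinAt y (q' * (c * y s ^ (1 / q) - g s)) (Icc 0 1) s
  map_one : y 1 = 0
  nonneg : ∀ s ∈ Icc (0 : ℝ) 1, 0 ≤ y s

section RpowApproximation

/-- The map `x ↦ x^α` truncated to the window `[e, C]`. -/
noncomputable def truncRpow (α e C x : ℝ) : ℝ := (min (max x e) C) ^ α

variable {α e C : ℝ}

theorem truncRpow_nonneg (he : 0 ≤ e) (hC : 0 ≤ C) (x : ℝ) : 0 ≤ truncRpow α e C x :=
  Real.rpow_nonneg (le_min (he.trans (le_max_right _ _)) hC) _

theorem truncRpow_le (hα : 0 ≤ α) (he : 0 ≤ e) (hC : 0 ≤ C) (x : ℝ) :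
    truncRpow α e C x ≤ C ^ α :=
  Real.rpow_le_rpow (le_min (he.trans (le_max_right _ _)) hC) (min_le_right _ _) hα

theorem truncRpow_monotone (hα : 0 ≤ α) (he : 0 ≤ e) (hC : 0 ≤ C) :
    Monotone (truncRpow α e C) := fun _ _ hxy =>
  Real.rpow_le_rpow (le_min (he.trans (le_max_right _ _)) hC)
    (min_le_min_right _ (max_le_max_right _ hxy)) hα

theorem truncRpow_mono_left (hα : 0 ≤ α) (he : 0 ≤ e) (hC : 0 ≤ C) {e' : ℝ} (h : e ≤ e') (x : ℝ) :
    truncRpow α e C x ≤ truncRpow α e' C x :=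
  Real.rpow_le_rpow (le_min (he.trans (le_max_right _ _)) hC)
    (min_le_min_right _ (max_le_max_left _ h)) hα

theorem truncRpow_of_mem {x : ℝ} (hx : x ∈ Icc e C) : truncRpow α e C x = x ^ α := by
  rw [truncRpow, max_eq_left hx.1, min_eq_left hx.2]

theorem tendsto_truncRpow (hα : 0 ≤ α) {x : ℝ} {u v : ℕ → ℝ} (hu : Tendsto u atTop (𝓝 e))
    (hv : Tendsto v atTop (𝓝 x)) :
    Tendsto (fun n => truncRpow α (u n) C (v n)) atTop (𝓝 (truncRpow α e C x)) :=
  ((hv.max hu).min tendsto_const_nhds).rpow_const (Or.inr hα)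

theorem continuous_truncRpow (hα : 0 ≤ α) : Continuous (truncRpow α e C) :=
  ((continuous_id.max continuous_const).min continuous_const).rpow_const fun _ => Or.inr hα

theorem exists_lipschitzWith_truncRpow (he : 0 < e) (heC : e ≤ C) :
    ∃ K, LipschitzWith K (truncRpow α e C) := by
  obtain ⟨K, hK⟩ := ContDiffOn.exists_lipschitzOnWith (n := 1) (s := Icc e C)
    (f := fun x : ℝ => x ^ α)
    (fun x hx => (Real.contDiffAt_rpow_const_of_ne (he.trans_le hx.1).ne').contDiffWithinAt)
    one_ne_zero (convex_Icc _ _) isCompact_Icc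
  have hclamp : LipschitzWith 1 fun x : ℝ => min (max x e) C :=
    (LipschitzWith.id.max_const e).min_const C
  refine ⟨K * 1, ?_⟩
  have := hK.comp (s := univ) hclamp.lipschitzOnWith
    (fun x _ => ⟨le_min (le_max_right _ _) heC, min_le_right _ _⟩)
  exact lipschitzOnWith_univ.1 this

end RpowApproximation

theorem exists_isPhaseCurve {q q' c : ℝ} {g : ℝ → ℝ} (hq : 0 < q) (hq' : 0 < q') (hc : 0 ≤ c)
    (hg : ContinuousOn g (Icc 0 1)) (hg0 : ∀ s ∈ Icc (0 : ℝ) 1, 0 ≤ g s) :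
    ∃ y, IsPhaseCurve q q' c g y := by
  obtain ⟨M, hM⟩ := isCompact_Icc.exists_bound_of_continuousOn hg
  have hM' : ∀ s ∈ Icc (0 : ℝ) 1, g s ≤ M := fun s hs => (le_abs_self _).trans (hM s hs)
  have hM0 : 0 ≤ M := (norm_nonneg _).trans (hM 0 (by simp))
  set C := max 1 (q' * M)
  have hC1 : 1 ≤ C := le_max_left _ _
  have hC0 : 0 ≤ C := zero_le_one.trans hC1
  have hα : 0 ≤ 1 / q := by positivity
  have hqc : 0 ≤ q' * c := by positivity
  let e : ℕ → ℝ := fun n => 1 / ((n : ℝ) + 1)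
  have he0 : ∀ n, 0 < e n := fun n => Nat.one_div_pos_of_nat
  have he1 : ∀ n, e n ≤ C := fun n => by
    refine le_trans ?_ hC1
    rw [div_le_one (by positivity)]
    linarith [(Nat.cast_nonneg n : (0 : ℝ) ≤ n)]
  choose K hK using fun n => exists_lipschitzWith_truncRpow (α := 1 / q) (he0 n) (he1 n)
  obtain ⟨y, hy1, hy⟩ := exists_backward_solution (ψ := fun x => q' * c * truncRpow (1 / q) 0 C x)
    (G := fun s => q' * g s) (B := q' * c * C ^ (1 / q) + q' * M)
    (fun n x => q' * c * truncRpow (1 / q) (e n) C x) (fun n => (q' * c).toNNReal * K n)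
    (fun n => by
      refine LipschitzWith.of_dist_le_mul fun x x' => ?_
      rw [Real.dist_eq, ← mul_sub, abs_mul, abs_of_nonneg hqc, NNReal.coe_mul,
        Real.coe_toNNReal _ hqc, mul_assoc (q' * c)]
      exact mul_le_mul_of_nonneg_left ((hK n).dist_le_mul x x') hqc)
    (fun n x x' hx => mul_le_mul_of_nonneg_left (truncRpow_monotone hα (he0 n).le hC0 hx) hqc)
    (fun x n m hnm => mul_le_mul_of_nonneg_left (truncRpow_mono_left hα (he0 m).le hC0
      (Nat.one_div_le_one_div hnm) x) hqc)
    (fun x u hu => (tendsto_truncRpow hα tendsto_one_div_add_atTop_nhds_zero_nat hu).const_mul _)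
    (continuous_const.mul (continuous_truncRpow hα)) (continuousOn_const.mul hg)
    (fun n x t ht => by
      have h1 := mul_le_mul_of_nonneg_left (truncRpow_le hα (he0 n).le hC0 x) hqc
      have h2 := mul_nonneg hqc (truncRpow_nonneg (α := 1 / q) (he0 n).le hC0 x)
      have h3 := mul_le_mul_of_nonneg_left (hM' t ht) hq'.le
      have h4 := mul_nonneg hq'.le (hg0 t ht)
      rw [abs_le]
      constructor <;> linarith)
  have hyc : ContinuousOn y (Icc 0 1) := HasDerivWithinAt.continuousOn hy
  have hyI : ∀ s ∈ Ioo (0 : ℝ) 1,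
      HasDerivAt y (q' * c * truncRpow (1 / q) 0 C (y s) - q' * g s) s :=
    fun s hs => (hy s (Ioo_subset_Icc_self hs)).hasDerivAt (Icc_mem_nhds hs.1 hs.2)
  have hnn : ∀ s ∈ Icc (0 : ℝ) 1, 0 ≤ y s := by
    refine le_of_hasDerivAt_le_of_lt (y' := fun _ => 0) continuousOn_const hyc
      (fun s _ => hasDerivAt_const s 0) hyI (fun s hs hlt => ?_) hy1.ge
    have h1 := mul_nonneg hq'.le (hg0 s (Ioo_subset_Icc_self hs))
    have h2 : truncRpow (1 / q) 0 C (y s) = 0 := by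
      rw [truncRpow, max_eq_right hlt.le, min_eq_left hC0, Real.zero_rpow (by positivity)]
    rw [h2]; linarith
  have hup : ∀ s ∈ Icc (0 : ℝ) 1, y s ≤ q' * M * (1 - s) := by
    refine le_of_hasDerivAt_le_of_lt (z' := fun _ => q' * M * (-1)) hyc (by fun_prop) hyI
      (fun s _ => ((hasDerivAt_id s).const_sub 1).const_mul _) (fun s hs _ => ?_) (by simp [hy1])
    have h1 := mul_le_mul_of_nonneg_left (hM' s (Ioo_subset_Icc_self hs)) hq'.le
    have h2 := mul_nonneg hqc (truncRpow_nonneg (α := 1 / q) le_rfl hC0 (y s))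
    linarith
  refine ⟨y, fun s hs => ?_, hy1, hnn⟩
  convert hy s hs using 1
  rw [truncRpow_of_mem ⟨hnn s hs, ?_⟩]
  · ring
  · have h1 := hup s hs
    have h2 : q' * M * (1 - s) ≤ q' * M * 1 :=
      mul_le_mul_of_nonneg_left (by linarith [hs.1]) (by positivity)
    exact h1.trans (h2.trans (by rw [mul_one]; exact le_max_right _ _))

namespace IsPhaseCurve

variable {q q' c : ℝ} {g y : ℝ → ℝ}

theorem continuousOn (h : IsPhaseCurve q q' c g y) : ContinuousOn y (Icc 0 1) :=
  HasDerivWithinAt.continuousOn h.hasDerivWithinAt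

theorem hasDerivAt (h : IsPhaseCurve q q' c g y) {s : ℝ} (hs : s ∈ Ioo (0 : ℝ) 1) :
    HasDerivAt y (q' * (c * y s ^ (1 / q) - g s)) s :=
  (h.hasDerivWithinAt s (Ioo_subset_Icc_self hs)).hasDerivAt (Icc_mem_nhds hs.1 hs.2)

theorem pos (h : IsPhaseCurve q q' c g y) (hq : 0 < q) (hq' : 0 < q')
    (hg : ∀ s ∈ Ioo (0 : ℝ) 1, 0 < g s) {s : ℝ} (hs : s ∈ Ioo (0 : ℝ) 1) : 0 < y s := by
  refine (h.nonneg s (Ioo_subset_Icc_self hs)).lt_of_ne' fun h0 => ?_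
  have hmin : IsLocalMin y s := by
    filter_upwards [Icc_mem_nhds hs.1 hs.2] with t ht
    rw [h0]; exact h.nonneg t ht
  have h1 := hmin.hasDerivAt_eq_zero (h.hasDerivAt hs)
  rw [h0, Real.zero_rpow (by positivity), mul_zero, zero_sub] at h1
  have := mul_pos hq' (hg s hs)
  linarith

/-- Quantitative dependence on the speed. -/
theorem le_add_mul {c₁ c₂ B : ℝ} {y₁ y₂ : ℝ → ℝ} (h₁ : IsPhaseCurve q q' c₁ g y₁)
    (h₂ : IsPhaseCurve q q' c₂ g y₂) (hq : 0 < q) (hq' : 0 < q') (hc₁ : 0 ≤ c₁)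
    (hB0 : 0 ≤ B) (hB : ∀ s ∈ Icc (0 : ℝ) 1, (c₂ - c₁) * y₂ s ^ (1 / q) ≤ B) :
    ∀ s ∈ Icc (0 : ℝ) 1, y₁ s ≤ y₂ s + q' * B * (1 - s) := by
  refine le_of_hasDerivAt_le_of_lt
    (z' := fun s => q' * (c₂ * y₂ s ^ (1 / q) - g s) + q' * B * (-1)) h₁.continuousOn
    (h₂.continuousOn.add (by fun_prop)) (fun s hs => h₁.hasDerivAt hs)
    (fun s hs => (h₂.hasDerivAt hs).add (((hasDerivAt_id s).const_sub 1).const_mul _))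
    (fun s hs hlt => ?_) (by simp [h₁.map_one, h₂.map_one])
  have hs' := Ioo_subset_Icc_self hs
  have hle : y₂ s ≤ y₁ s := by
    have : 0 ≤ q' * B * (1 - s) := mul_nonneg (by positivity) (by linarith [hs.2])
    linarith
  have hpow : y₂ s ^ (1 / q) ≤ y₁ s ^ (1 / q) :=
    Real.rpow_le_rpow (h₂.nonneg s hs') hle (by positivity)
  have h3 := hB s hs'
  have h4 := mul_le_mul_of_nonneg_left hpow hc₁
  have h5 : q' * (c₂ * y₂ s ^ (1 / q)) ≤ q' * (c₁ * y₁ s ^ (1 / q) + B) :=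
    mul_le_mul_of_nonneg_left (by linarith) hq'.le
  linarith

/-- Phase curves decrease with the speed. -/
theorem le_of_speed_le {c₁ c₂ : ℝ} {y₁ y₂ : ℝ → ℝ} (h₁ : IsPhaseCurve q q' c₁ g y₁)
    (h₂ : IsPhaseCurve q q' c₂ g y₂) (hq : 0 < q) (hq' : 0 < q') (hc₂ : 0 ≤ c₂) (hc : c₂ ≤ c₁) :
    ∀ s ∈ Icc (0 : ℝ) 1, y₁ s ≤ y₂ s := by
  intro s hs
  have := h₁.le_add_mul h₂ hq hq' (hc₂.trans hc) le_rfl (fun t ht =>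
    mul_nonpos_of_nonpos_of_nonneg (by linarith) (Real.rpow_nonneg (h₂.nonneg t ht) _)) s hs
  simpa using this

/-- Barriers: `z` bounds the flux of a phase curve from above if `z' ≤ c - g / z^(q'-1)`
(written without the division) and it does so at the right end point. -/
theorem le_rpow_of_barrier (h : IsPhaseCurve q q' c g y) (hqq' : q.HolderConjugate q')
    (hc : 0 ≤ c) {a b : ℝ} (ha : 0 ≤ a) (hb : b ≤ 1) {z z' : ℝ → ℝ}
    (hz : ContinuousOn z (Icc a b)) (hz' : ∀ s ∈ Ioo a b, HasDerivAt z (z' s) s)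
    (hz0 : ∀ s ∈ Ioo a b, 0 ≤ z s)
    (hbar : ∀ s ∈ Ioo a b, g s ≤ (c - z' s) * z s ^ (q' - 1)) (hyb : y b ≤ z b ^ q') :
    ∀ s ∈ Icc a b, y s ≤ z s ^ q' := by
  have hsub : Icc a b ⊆ Icc (0 : ℝ) 1 := Icc_subset_Icc ha hb
  have hsub' : Ioo a b ⊆ Ioo (0 : ℝ) 1 := Ioo_subset_Ioo ha hb
  have hq := hqq'.pos
  have hq' := hqq'.symm.pos
  refine le_of_hasDerivAt_le_of_lt (z' := fun s => z' s * q' * z s ^ (q' - 1))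
    (h.continuousOn.mono hsub) (hz.rpow_const fun _ _ => Or.inr hq'.le)
    (fun s hs => h.hasDerivAt (hsub' hs))
    (fun s hs => (hz' s hs).rpow_const (Or.inr hqq'.symm.lt.le)) (fun s hs hlt => ?_) hyb
  have h1 : z s ^ (q' - 1) ≤ y s ^ (1 / q) := by
    rw [← rpow_conj_rpow_one_div hqq' (hz0 s hs)]
    exact Real.rpow_le_rpow (Real.rpow_nonneg (hz0 s hs) _) hlt.le (by positivity)
  have h2 := hbar s hs
  have h3 := mul_le_mul_of_nonneg_left h1 hc
  have h4 : q' * (z' s * z s ^ (q' - 1)) ≤ q' * (c * y s ^ (1 / q) - g s) :=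
    mul_le_mul_of_nonneg_left (by linarith) hq'.le
  linarith

end IsPhaseCurve

/-! ### The speed bound as a minimum -/

section SpeedBound

variable {q q' : ℝ}

theorem speedBound_nonneg (hqq' : q.HolderConjugate q') {L : ℝ} (hL : 0 ≤ L) :
    0 ≤ speedBound q q' L := by
  have := hqq'.pos
  have := hqq'.symm.pos
  unfold speedBound
  positivity

theorem speedBound_pos (hqq' : q.HolderConjugate q') {L : ℝ} (hL : 0 < L) :
    0 < speedBound q q' L := by
  have := hqq'.pos
  have := hqq'.symm.pos
  unfold speedBound
  positivity

/-- The speed bound is a lower bound of `x + 2^(q'-1) L / x^(q'-1)`, by Young's inequality. -/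
theorem speedBound_le_add_div (hqq' : q.HolderConjugate q') {L x : ℝ} (hL : 0 ≤ L) (hx : 0 < x) :
    speedBound q q' L ≤ x + 2 ^ (q' - 1) * L / x ^ (q' - 1) := by
  have hq := hqq'.pos
  have hq' := hqq'.symm.pos
  have hr := sub_one_mul_one_div hqq'
  set X := x ^ (q' - 1)
  have hX : 0 < X := Real.rpow_pos_of_pos hx _
  have hAM := Real.geom_mean_le_arith_mean2_weighted (w₁ := 1 / q) (w₂ := 1 / q') (p₁ := q * x)
    (p₂ := q' * (2 ^ (q' - 1) * L / X)) (by positivity) (by positivity) (by positivity)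
    (by positivity) (by rw [one_div, one_div]; exact hqq'.inv_add_inv_eq_one)
  have h1 : 1 / q * (q * x) + 1 / q' * (q' * (2 ^ (q' - 1) * L / X)) =
      x + 2 ^ (q' - 1) * L / X := by field_simp
  rw [h1] at hAM
  refine le_trans (le_of_eq ?_) hAM
  have h2 : X ^ (1 / q') = x ^ (1 / q) := by rw [← Real.rpow_mul hx.le, hr]
  have h3 : ((2 : ℝ) ^ (q' - 1)) ^ (1 / q') = 2 ^ (1 / q) := by
    rw [← Real.rpow_mul zero_le_two, hr]
  have h4 : 0 < x ^ (1 / q) := Real.rpow_pos_of_pos hx _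
  rw [Real.mul_rpow hq.le hx.le, Real.mul_rpow hq'.le (by positivity),
    Real.div_rpow (by positivity) hX.le, Real.mul_rpow (by positivity) hL, h2, h3, speedBound]
  field_simp

/-- The minimum of `x + 2^(q'-1) L / x^(q'-1)` is attained at `x = speedBound q q' L / q`. -/
theorem sub_mul_rpow_speedBound (hqq' : q.HolderConjugate q') {L : ℝ} (hL : 0 ≤ L) :
    (speedBound q q' L - speedBound q q' L / q) * (speedBound q q' L / q) ^ (q' - 1) =
      2 ^ (q' - 1) * L := by
  have hq := hqq'.pos
  have hq' := hqq'.symm.pos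
  have hC := speedBound_nonneg hqq' hL
  have hpow : speedBound q q' L ^ q' = 2 ^ (q' - 1) * L * q' * q ^ (q' - 1) := by
    have e1 : 1 / q' * q' = 1 := one_div_mul_cancel hq'.ne'
    have e2 : 1 / q * q' = q' - 1 := by
      rw [← sub_one_mul_one_div hqq', mul_assoc, e1, mul_one]
    rw [speedBound, Real.mul_rpow (by positivity) (by positivity),
      Real.mul_rpow (by positivity) (by positivity), Real.mul_rpow (by positivity) (by positivity),
      ← Real.rpow_mul zero_le_two, ← Real.rpow_mul hL, ← Real.rpow_mul hq'.le,
      ← Real.rpow_mul hq.le, e1, e2, Real.rpow_one, Real.rpow_one]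
  have h1 : speedBound q q' L - speedBound q q' L / q = speedBound q q' L / q' := by
    have := hqq'.mul_eq_add
    field_simp
    linear_combination speedBound q q' L * this
  have h2 : speedBound q q' L * speedBound q q' L ^ (q' - 1) = speedBound q q' L ^ q' := by
    rcases hC.eq_or_lt with h0 | h0
    · rw [← h0, zero_mul, Real.zero_rpow hq'.ne']
    · rw [Real.rpow_sub_one h0.ne']; field_simp
  rw [h1, Real.div_rpow hC hq.le, div_mul_div_comm, h2, hpow]
  field_simp

end SpeedBound

/-! ### Asymptotics of phase curves at the two equilibria -/

namespace IsPhaseCurve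

variable {q q' c : ℝ} {g y : ℝ → ℝ}

/-- The flux `w = y^(1/q')` along a phase curve satisfies `w' = c - g / w^(q'-1)`. -/
theorem hasDerivAt_flux (h : IsPhaseCurve q q' c g y) (hqq' : q.HolderConjugate q') {s : ℝ}
    (hs : s ∈ Ioo (0 : ℝ) 1) (hy : 0 < y s) :
    HasDerivAt (fun t => y t ^ (1 / q')) (c - g s / y s ^ (1 / q)) s := by
  refine ((h.hasDerivAt hs).rpow_const (p := 1 / q') (Or.inl hy.ne')).congr_deriv ?_
  have hY : 0 < y s ^ (1 / q) := Real.rpow_pos_of_pos hy _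
  have he : 1 / q' - 1 = -(1 / q) := by
    rw [one_div, one_div]; linarith [hqq'.inv_add_inv_eq_one]
  rw [he, Real.rpow_neg hy.le]
  have := hqq'.symm.pos
  field_simp

theorem continuousOn_flux (h : IsPhaseCurve q q' c g y) (hqq' : q.HolderConjugate q') :
    ContinuousOn (fun t => y t ^ (1 / q')) (Icc 0 1) :=
  h.continuousOn.rpow_const fun _ _ => Or.inr hqq'.symm.one_div_nonneg

theorem flux_le (h : IsPhaseCurve q q' c g y) (hqq' : q.HolderConjugate q')
    (hg : ∀ s ∈ Ioo (0 : ℝ) 1, 0 < g s) (hy0 : y 0 = 0) :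
    ∀ s ∈ Icc (0 : ℝ) 1, y s ^ (1 / q') ≤ c * s := by
  have hanti : AntitoneOn (fun t => y t ^ (1 / q') - c * t) (Icc 0 1) := by
    refine antitoneOn_of_hasDerivWithinAt_nonpos (convex_Icc 0 1)
      (f' := fun s => c - g s / y s ^ (1 / q) - c * 1)
      ((h.continuousOn_flux hqq').sub (by fun_prop)) ?_ ?_
    · intro s hs
      rw [interior_Icc] at hs
      exact ((h.hasDerivAt_flux hqq' hs (h.pos hqq'.pos hqq'.symm.pos hg hs)).sub
        ((hasDerivAt_id s).const_mul c)).hasDerivWithinAt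
    · intro s hs
      rw [interior_Icc] at hs
      have := div_nonneg (hg s hs).le
        (Real.rpow_nonneg (h.nonneg s (Ioo_subset_Icc_self hs)) (1 / q))
      linarith
  intro s hs
  have := hanti (left_mem_Icc.2 zero_le_one) hs hs.1
  simp only [hy0, Real.zero_rpow (one_div_ne_zero hqq'.symm.ne_zero)] at this
  linarith

theorem le_rpow_of_flux_le (h : IsPhaseCurve q q' c g y) (hqq' : q.HolderConjugate q') {s x : ℝ}
    (hs : s ∈ Icc (0 : ℝ) 1) (hx : y s ^ (1 / q') ≤ x) : y s ≤ x ^ q' := by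
  have := Real.rpow_le_rpow (Real.rpow_nonneg (h.nonneg s hs) _) hx hqq'.symm.nonneg
  rwa [← Real.rpow_mul (h.nonneg s hs), one_div_mul_cancel hqq'.symm.ne_zero,
    Real.rpow_one] at this

/-- If `g` is at least `2^(q'-1) L s^(q'-1)` near `0`, a phase curve reaching `0` at `s = 0` has
speed at least `speedBound q q' L`: otherwise the ratio `w / s` would grow like `log (1 / s)` as
`s → 0`, against `w ≤ c s`. -/
theorem speedBound_le (h : IsPhaseCurve q q' c g y) (hqq' : q.HolderConjugate q')
    (hg : ∀ s ∈ Ioo (0 : ℝ) 1, 0 < g s) (hy0 : y 0 = 0) {L σ : ℝ} (hL : 0 ≤ L) (hσ0 : 0 < σ)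
    (hσ1 : σ ≤ 1) (hgL : ∀ s ∈ Ioo 0 σ, 2 ^ (q' - 1) * L * s ^ (q' - 1) ≤ g s) :
    speedBound q q' L ≤ c := by
  by_contra! hlt
  set δ := speedBound q q' L - c with hδ
  have hδ0 : 0 < δ := by linarith
  have hsub : Ioo 0 σ ⊆ Ioo (0 : ℝ) 1 := Ioo_subset_Ioo le_rfl hσ1
  have hd : ∀ s ∈ Ioo 0 σ, HasDerivAt (fun t => y t ^ (1 / q') / t + δ * Real.log t)
      (((c - g s / y s ^ (1 / q)) * s - y s ^ (1 / q') * 1) / s ^ 2 + δ * s⁻¹) s := fun s hs =>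
    ((h.hasDerivAt_flux hqq' (hsub hs) (h.pos hqq'.pos hqq'.symm.pos hg (hsub hs))).div
      (hasDerivAt_id s) hs.1.ne').add ((Real.hasDerivAt_log hs.1.ne').const_mul δ)
  have hanti : AntitoneOn (fun t => y t ^ (1 / q') / t + δ * Real.log t) (Ioo 0 σ) := by
    refine antitoneOn_of_hasDerivWithinAt_nonpos (convex_Ioo 0 σ)
      (fun s hs => (hd s hs).continuousAt.continuousWithinAt)
      (fun s hs => (hd s (interior_subset hs)).hasDerivWithinAt) fun s hs => ?_
    rw [interior_Ioo] at hs
    have hs0 : 0 < s := hs.1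
    have hypos := h.pos hqq'.pos hqq'.symm.pos hg (hsub hs)
    set W := y s ^ (1 / q') with hW
    have hW0 : 0 < W := Real.rpow_pos_of_pos hypos _
    have hρ : 0 < W / s := div_pos hW0 hs0
    have h1 := speedBound_le_add_div hqq' hL hρ
    have h2 : (W / s) ^ (q' - 1) = y s ^ (1 / q) / s ^ (q' - 1) := by
      rw [Real.div_rpow hW0.le hs0.le, hW, rpow_one_div_conj_rpow_sub_one hqq' hypos.le]
    have hY : 0 < y s ^ (1 / q) := Real.rpow_pos_of_pos hypos _
    have h3 : 2 ^ (q' - 1) * L / (W / s) ^ (q' - 1) ≤ g s / y s ^ (1 / q) := by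
      rw [h2, div_div_eq_mul_div]
      exact div_le_div_of_nonneg_right (hgL s hs) hY.le
    have h4 : c - g s / y s ^ (1 / q) - W / s + δ ≤ 0 := by linarith
    have h5 : ((c - g s / y s ^ (1 / q)) * s - W * 1) / s ^ 2 + δ * s⁻¹ =
        (c - g s / y s ^ (1 / q) - W / s + δ) / s := by
      field_simp
    rw [h5]
    exact div_nonpos_of_nonpos_of_nonneg h4 hs0.le
  have hs0 : σ / 2 ∈ Ioo 0 σ := ⟨by linarith, by linarith⟩
  have hlog : Tendsto (fun t => c + δ * Real.log t) (𝓝[>] 0) atBot :=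
    tendsto_atBot_add_const_left _ _ (Real.tendsto_log_nhdsGT_zero.const_mul_atBot hδ0)
  obtain ⟨s, hs1, hs2, hs3⟩ := ((hlog.eventually_lt_atBot
    (y (σ / 2) ^ (1 / q') / (σ / 2) + δ * Real.log (σ / 2))).and
    ((eventually_mem_nhdsWithin).and (Ioo_mem_nhdsGT hs0.1))).exists
  have h1 := hanti ⟨hs2, hs3.2.trans hs0.2⟩ hs0 hs3.2.le
  have h2 : y s ^ (1 / q') / s ≤ c :=
    (div_le_iff₀ hs2).2 (h.flux_le hqq' hg hy0 s ⟨hs3.1.le, by linarith [hs3.2]⟩)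
  dsimp only at h1
  linarith

/-- At the speed `speedBound q q' L`, the line through the minimum point is a barrier. -/
theorem le_linear_of_speedBound {L : ℝ} (h : IsPhaseCurve q q' (speedBound q q' L) g y)
    (hqq' : q.HolderConjugate q') (hL : 0 ≤ L)
    (hgL : ∀ s ∈ Ioo (0 : ℝ) 1, g s ≤ 2 ^ (q' - 1) * L * s ^ (q' - 1)) :
    ∀ s ∈ Icc (0 : ℝ) 1, y s ≤ (speedBound q q' L / q * s) ^ q' := by
  have hC := speedBound_nonneg hqq' hL
  have hCq : 0 ≤ speedBound q q' L / q := div_nonneg hC hqq'.nonneg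
  refine h.le_rpow_of_barrier hqq' hC le_rfl le_rfl (z' := fun _ => speedBound q q' L / q * 1)
    (by fun_prop) (fun s _ => (hasDerivAt_id s).const_mul _)
    (fun s hs => mul_nonneg hCq hs.1.le) (fun s hs => ?_) ?_
  · rw [mul_one, Real.mul_rpow hCq hs.1.le, ← mul_assoc, sub_mul_rpow_speedBound hqq' hL]
    exact hgL s hs
  · rw [h.map_one]; exact Real.rpow_nonneg (by simpa using hCq) _

/-- If `g` vanishes at least linearly at `1`, so does `y^(1/q)`, which is a multiple of the
derivative of the front; hence the front needs an infinite time to reach `1`. -/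
theorem exists_rpow_le_mul_one_sub (h : IsPhaseCurve q q' c g y) (hqq' : q.HolderConjugate q')
    (hq2 : 2 ≤ q) (hc : 0 < c) {k : ℝ} (hk : 0 < k)
    (hgk : ∀ s ∈ Ioo (0 : ℝ) 1, g s ≤ k * (1 - s)) :
    ∃ K > 0, ∀ s ∈ Icc (0 : ℝ) 1, y s ^ (1 / q) ≤ K * (1 - s) := by
  have hkc : 0 < k / c := div_pos hk hc
  set K := (k / c) ^ (q - 1) with hK
  have hK0 : 0 < K := Real.rpow_pos_of_pos hkc _
  have hKr : K ^ (q' - 1) = k / c := rpow_sub_one_rpow_conj_sub_one hqq' hkc.le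
  have hzr : ∀ s ≤ (1 : ℝ), (K * (1 - s) ^ (q - 1)) ^ (q' - 1) = k / c * (1 - s) := by
    intro s hs
    rw [Real.mul_rpow hK0.le (Real.rpow_nonneg (by linarith) _), hKr,
      rpow_sub_one_rpow_conj_sub_one hqq' (by linarith)]
  have hz0 : ∀ s ≤ (1 : ℝ), 0 ≤ K * (1 - s) ^ (q - 1) := fun s hs =>
    mul_nonneg hK0.le (Real.rpow_nonneg (by linarith) _)
  have hbar := h.le_rpow_of_barrier hqq' hc.le le_rfl le_rfl
    (z := fun s => K * (1 - s) ^ (q - 1))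
    (z' := fun s => K * (-1 * (q - 1) * (1 - s) ^ (q - 1 - 1)))
    (continuousOn_const.mul ((continuousOn_const.sub continuousOn_id).rpow_const
      fun _ _ => Or.inr (by linarith)))
    (fun s _ => (((hasDerivAt_id s).const_sub 1).rpow_const (Or.inr (by linarith))).const_mul K)
    (fun s hs => hz0 s hs.2.le) (fun s hs => ?_) ?_
  · refine ⟨k / c, hkc, fun s hs => ?_⟩
    have h1 := Real.rpow_le_rpow (h.nonneg s hs) (hbar s hs) hqq'.one_div_nonneg
    rwa [rpow_conj_rpow_one_div hqq' (hz0 s hs.2), hzr s hs.2] at h1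
  · simp only [hzr s hs.2.le]
    refine (hgk s hs).trans ?_
    have h1 : 0 ≤ K * ((q - 1) * (1 - s) ^ (q - 1 - 1)) :=
      mul_nonneg hK0.le (mul_nonneg (by linarith) (Real.rpow_nonneg (by linarith [hs.2]) _))
    have h2 : 0 ≤ k / c * (1 - s) := mul_nonneg hkc.le (by linarith [hs.2])
    calc k * (1 - s) = c * (k / c * (1 - s)) := by field_simp
      _ ≤ _ := mul_le_mul_of_nonneg_right (by linarith) h2
  · rw [h.map_one]; exact Real.rpow_nonneg (hz0 1 le_rfl) _

/-- Power barriers `a s₁ (s / s₁)^m` with `1 ≤ m ≤ q - 1` near `s = 0`. -/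
theorem eventually_le_power_barrier (h : IsPhaseCurve q q' c g y) (hqq' : q.HolderConjugate q')
    (hq2 : 2 < q) {a m M : ℝ} (ha : 0 < a) (hm1 : 1 ≤ m) (hmq : m ≤ q - 1) (ham : a * m < c)
    (hgM : ∀ s ∈ Ioo (0 : ℝ) 1, g s ≤ M * s) :
    ∀ᶠ s₁ in 𝓝[>] (0 : ℝ), y s₁ ≤ (a * s₁) ^ q' →
      ∀ s ∈ Icc 0 s₁, y s ≤ (a * s₁ * (s / s₁) ^ m) ^ q' := by
  have hc : 0 < c := lt_of_le_of_lt (by positivity) ham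
  have hr0 : 0 < q' - 1 := hqq'.symm.sub_one_pos
  have hqr : (q - 1) * (q' - 1) = 1 := by linarith [hqq'.mul_eq_add]
  have hr1 : 0 < 1 - (q' - 1) := by nlinarith
  have hmr : m * (q' - 1) ≤ 1 := (mul_le_mul_of_nonneg_right hmq hr0.le).trans hqr.le
  have hA : 0 < (c - a * m) * a ^ (q' - 1) := mul_pos (by linarith) (Real.rpow_pos_of_pos ha _)
  have hlim : Tendsto (fun t : ℝ => M * t ^ (1 - (q' - 1))) (𝓝[>] 0) (𝓝 0) := by
    have : Tendsto (fun t : ℝ => M * t ^ (1 - (q' - 1))) (𝓝 0)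
        (𝓝 (M * (0 : ℝ) ^ (1 - (q' - 1)))) :=
      (tendsto_id.rpow_const (Or.inr hr1.le)).const_mul M
    rw [Real.zero_rpow hr1.ne', mul_zero] at this
    exact this.mono_left nhdsWithin_le_nhds
  filter_upwards [hlim.eventually_lt_const hA, Ioo_mem_nhdsGT one_pos] with s₁ hs₁ hs₁1 hys₁
  have h0 : 0 < s₁ := hs₁1.1
  have hzc : Continuous fun s : ℝ => a * s₁ * (s / s₁) ^ m :=
    continuous_const.mul ((continuous_id.div_const _).rpow_const fun _ => Or.inr (by linarith))
  refine h.le_rpow_of_barrier hqq' hc.le le_rfl hs₁1.2.le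
    (z' := fun s => a * s₁ * (1 / s₁ * m * (s / s₁) ^ (m - 1))) hzc.continuousOn
    (fun s _ => (((hasDerivAt_id s).div_const s₁).rpow_const (Or.inr hm1)).const_mul _)
    (fun s hs => by have := hs.1; positivity) (fun s hs => ?_) ?_
  · have hs0 : 0 < s := hs.1
    have ht0 : 0 < s / s₁ := div_pos hs0 h0
    have ht1 : s / s₁ ≤ 1 := (div_le_one h0).2 hs.2.le
    have hz' : a * s₁ * (1 / s₁ * m * (s / s₁) ^ (m - 1)) ≤ a * m := by
      have h1 : (s / s₁) ^ (m - 1) ≤ 1 := Real.rpow_le_one ht0.le ht1 (by linarith)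
      have h2 : a * s₁ * (1 / s₁ * m * (s / s₁) ^ (m - 1)) = a * m * (s / s₁) ^ (m - 1) := by
        field_simp
      rw [h2]
      exact mul_le_of_le_one_right (by positivity) h1
    have hzr : a ^ (q' - 1) * s₁ ^ (q' - 1) * (s / s₁) ≤
        (a * s₁ * (s / s₁) ^ m) ^ (q' - 1) := by
      rw [Real.mul_rpow (by positivity) (by positivity), Real.mul_rpow ha.le h0.le,
        ← Real.rpow_mul ht0.le]
      refine mul_le_mul_of_nonneg_left ?_ (by positivity)
      calc s / s₁ = (s / s₁) ^ (1 : ℝ) := (Real.rpow_one _).symm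
        _ ≤ _ := Real.rpow_le_rpow_of_exponent_ge ht0 ht1 hmr
    have hpow : s₁ ^ (1 - (q' - 1)) * s₁ ^ (q' - 1) = s₁ := by
      rw [← Real.rpow_add h0, sub_add_cancel, Real.rpow_one]
    calc g s ≤ M * s := hgM s ⟨hs0, hs.2.trans hs₁1.2⟩
      _ = M * s₁ ^ (1 - (q' - 1)) * (s₁ ^ (q' - 1) * (s / s₁)) := by
          rw [mul_assoc, ← mul_assoc (s₁ ^ (1 - (q' - 1))), hpow]; field_simp
      _ ≤ (c - a * m) * a ^ (q' - 1) * (s₁ ^ (q' - 1) * (s / s₁)) :=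
          mul_le_mul_of_nonneg_right hs₁.le (by positivity)
      _ = (c - a * m) * (a ^ (q' - 1) * s₁ ^ (q' - 1) * (s / s₁)) := by ring
      _ ≤ (c - a * m) * (a * s₁ * (s / s₁) ^ m) ^ (q' - 1) :=
          mul_le_mul_of_nonneg_left hzr (by linarith)
      _ ≤ _ := mul_le_mul_of_nonneg_right (by linarith) (by positivity)
  · rwa [div_self h0.ne', Real.one_rpow, mul_one]

/-- For `q > 2` and `g = O(s)` two behaviours of the flux at `0` compete, `w ~ c s` and
`w = O(s^(q-1))`. A bound `w ≤ a s` with `a < c` excludes the first one, and in the second one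
`y^(1/q) = w^(q'-1)` vanishes at least linearly. -/
theorem exists_rpow_le_mul (h : IsPhaseCurve q q' c g y) (hqq' : q.HolderConjugate q')
    (hq2 : 2 < q) {a M : ℝ} (ha : 0 < a) (hac : a < c)
    (hgM : ∀ s ∈ Ioo (0 : ℝ) 1, g s ≤ M * s)
    (hya : ∀ s ∈ Icc (0 : ℝ) 1, y s ≤ (a * s) ^ q') :
    ∃ K > 0, ∃ σ ∈ Ioo (0 : ℝ) 1, ∀ s ∈ Icc 0 σ, y s ^ (1 / q) ≤ K * s := by
  have hc : 0 < c := ha.trans hac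
  -- A power barrier with exponent slightly above `1` shows that `w = o(s)`.
  obtain ⟨m, hm1, hm⟩ : ∃ m, 1 < m ∧ m < min (q - 1) (c / a) :=
    exists_between (lt_min (by linarith) ((one_lt_div ha).2 hac))
  have ham : a * m < c := by
    have := (lt_div_iff₀ ha).1 (hm.trans_le (min_le_right _ _))
    linarith
  obtain ⟨s₁, hbar, hs₁⟩ := ((h.eventually_le_power_barrier hqq' hq2 ha hm1.le
    (hm.trans_le (min_le_left _ _)).le ham hgM).and (Ioo_mem_nhdsGT one_pos)).exists
  have hb1 := hbar (hya s₁ (Ioo_subset_Icc_self hs₁))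
  have h0 : 0 < s₁ := hs₁.1
  -- Below that, a barrier with the exponent `q - 1` and an arbitrarily small slope applies.
  set κ := c / (2 * (q - 1)) with hκ
  have hq1 : 0 < q - 1 := by linarith
  have hκ0 : 0 < κ := div_pos hc (by linarith)
  have hκc : κ * (q - 1) < c := by
    have : κ * (q - 1) = c / 2 := by rw [hκ]; field_simp
    linarith
  have hlim : Tendsto (fun t : ℝ => a * (t / s₁) ^ (m - 1)) (𝓝[>] 0) (𝓝 0) := by
    have : Tendsto (fun t : ℝ => a * (t / s₁) ^ (m - 1)) (𝓝 0)
        (𝓝 (a * ((0 : ℝ) / s₁) ^ (m - 1))) :=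
      ((tendsto_id.div_const s₁).rpow_const (Or.inr (by linarith))).const_mul a
    rw [zero_div, Real.zero_rpow (by linarith), mul_zero] at this
    exact this.mono_left nhdsWithin_le_nhds
  obtain ⟨s₂, hbar₂, hs₂κ, hs₂⟩ := ((h.eventually_le_power_barrier hqq' hq2 hκ0 (by linarith)
    le_rfl hκc hgM).and ((hlim.eventually_lt_const hκ0).and (Ioo_mem_nhdsGT h0))).exists
  have h20 : 0 < s₂ := hs₂.1
  have hb2 := hbar₂ (by
    refine (hb1 s₂ (Ioo_subset_Icc_self hs₂)).trans ?_
    refine Real.rpow_le_rpow (by positivity) ?_ hqq'.symm.nonneg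
    have ht : 0 < s₂ / s₁ := div_pos h20 h0
    calc a * s₁ * (s₂ / s₁) ^ m = a * (s₂ / s₁) ^ (m - 1) * s₂ := by
          rw [Real.rpow_sub_one ht.ne']; field_simp
      _ ≤ κ * s₂ := mul_le_mul_of_nonneg_right hs₂κ.le h20.le)
  refine ⟨(κ * s₂) ^ (q' - 1) / s₂, by positivity, s₂, ⟨h20, hs₂.2.trans hs₁.2⟩, fun s hs => ?_⟩
  have hs0 : 0 ≤ s := hs.1
  have h1 := Real.rpow_le_rpow
    (h.nonneg s ⟨hs0, hs.2.trans (hs₂.2.trans hs₁.2).le⟩) (hb2 s hs) hqq'.one_div_nonneg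
  rw [rpow_conj_rpow_one_div hqq' (by positivity), Real.mul_rpow (by positivity) (by positivity),
    rpow_sub_one_rpow_conj_sub_one hqq' (by positivity)] at h1
  calc y s ^ (1 / q) ≤ _ := h1
    _ = _ := by ring

end IsPhaseCurve

/-! ### Monotone profiles of an autonomous equation `v' = h(v)` -/

/-- The profile as a generalized inverse of the travel time `T`: the largest state reached by
time `z`, or `0` if no state of `(0, 1)` has been reached. -/
noncomputable def profileOf (T : ℝ → ℝ) (z : ℝ) : ℝ :=
  sSup (insert 0 {s | s ∈ Ioo (0 : ℝ) 1 ∧ T s ≤ z})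

section Profile

variable {h T : ℝ → ℝ}

theorem exists_travel_time (hc : ContinuousOn h (Icc 0 1)) (hpos : ∀ s ∈ Ioo (0 : ℝ) 1, 0 < h s) :
    ∃ T : ℝ → ℝ, ∀ s ∈ Ioo (0 : ℝ) 1, HasDerivAt T (h s)⁻¹ s := by
  have hinv : ContinuousOn (fun s => (h s)⁻¹) (Ioo 0 1) :=
    (hc.mono Ioo_subset_Icc_self).inv₀ fun s hs => (hpos s hs).ne'
  refine ⟨fun s => ∫ t in (1 / 2 : ℝ)..s, (h t)⁻¹, fun s hs => ?_⟩
  have hsub : uIcc (1 / 2) s ⊆ Ioo (0 : ℝ) 1 :=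
    ordConnected_Ioo.uIcc_subset (by norm_num) hs
  exact intervalIntegral.integral_hasDerivAt_right (hinv.mono hsub).intervalIntegrable
    (hinv.stronglyMeasurableAtFilter isOpen_Ioo s hs) (hinv.continuousAt (Ioo_mem_nhds hs.1 hs.2))



theorem strictMonoOn_travel_time (hpos : ∀ s ∈ Ioo (0 : ℝ) 1, 0 < h s)
    (hT : ∀ s ∈ Ioo (0 : ℝ) 1, HasDerivAt T (h s)⁻¹ s) : StrictMonoOn T (Ioo 0 1) := by
  refine strictMonoOn_of_deriv_pos (convex_Ioo 0 1)
    (fun s hs => (hT s hs).continuousAt.continuousWithinAt) fun s hs => ?_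
  rw [interior_Ioo] at hs
  rw [(hT s hs).deriv]
  exact inv_pos.2 (hpos s hs)

theorem exists_lt_travel_time (hpos : ∀ s ∈ Ioo (0 : ℝ) 1, 0 < h s)
    (hT : ∀ s ∈ Ioo (0 : ℝ) 1, HasDerivAt T (h s)⁻¹ s)
    {K : ℝ} (hK : 0 < K)
    (hK1 : ∀ s ∈ Icc (0 : ℝ) 1, h s ≤ K * (1 - s)) (z : ℝ) : ∃ s ∈ Ioo (0 : ℝ) 1, z < T s := by
  have hd : ∀ s ∈ Ioo (0 : ℝ) 1, HasDerivAt (fun t => T t + K⁻¹ * Real.log (1 - t))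
      ((h s)⁻¹ + K⁻¹ * (-1 / (1 - s))) s := fun s hs =>
    (hT s hs).add ((((hasDerivAt_id s).const_sub 1).log (sub_pos.2 hs.2).ne').const_mul _)
  have hmono : MonotoneOn (fun t => T t + K⁻¹ * Real.log (1 - t)) (Ioo 0 1) := by
    refine monotoneOn_of_hasDerivWithinAt_nonneg (convex_Ioo 0 1)
      (fun s hs => (hd s hs).continuousAt.continuousWithinAt)
      (fun s hs => (hd s (interior_subset hs)).hasDerivWithinAt) fun s hs => ?_
    rw [interior_Ioo] at hs
    have h1 := inv_anti₀ (hpos s hs) (hK1 s (Ioo_subset_Icc_self hs))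
    rw [mul_inv] at h1
    have h2 : K⁻¹ * (-1 / (1 - s)) = -(K⁻¹ * (1 - s)⁻¹) := by ring
    rw [h2]; linarith
  have hlim : Tendsto (fun t : ℝ => K⁻¹ * Real.log t) (𝓝[>] 0) atBot :=
    Real.tendsto_log_nhdsGT_zero.const_mul_atBot (inv_pos.2 hK)
  obtain ⟨t, ht1, ht2⟩ := ((hlim.eventually_lt_atBot
    (T (1 / 2) + K⁻¹ * Real.log (1 - 1 / 2) - z)).and
    (Ioo_mem_nhdsGT (show (0 : ℝ) < 1 / 2 by norm_num))).exists
  have hs : 1 - t ∈ Ioo (0 : ℝ) 1 := ⟨by linarith [ht2.2], by linarith [ht2.1]⟩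
  have h1 := hmono (show (1 / 2 : ℝ) ∈ Ioo (0 : ℝ) 1 by norm_num) hs (by linarith [ht2.2])
  simp only [sub_sub_cancel] at h1
  exact ⟨1 - t, hs, by linarith⟩

theorem exists_travel_time_lt (hpos : ∀ s ∈ Ioo (0 : ℝ) 1, 0 < h s)
    (hT : ∀ s ∈ Ioo (0 : ℝ) 1, HasDerivAt T (h s)⁻¹ s)
    {K σ : ℝ} (hK : 0 < K) (hσ : σ ∈ Ioo (0 : ℝ) 1)
    (hK0 : ∀ s ∈ Icc (0 : ℝ) σ, h s ≤ K * s) (z : ℝ) : ∃ s ∈ Ioo (0 : ℝ) 1, T s < z := by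
  have hsub : Ioc 0 σ ⊆ Ioo (0 : ℝ) 1 := fun s hs => ⟨hs.1, hs.2.trans_lt hσ.2⟩
  have hd : ∀ s ∈ Ioc 0 σ, HasDerivAt (fun t => T t - K⁻¹ * Real.log t)
      ((h s)⁻¹ - K⁻¹ * s⁻¹) s := fun s hs =>
    (hT s (hsub hs)).sub ((Real.hasDerivAt_log hs.1.ne').const_mul _)
  have hmono : MonotoneOn (fun t => T t - K⁻¹ * Real.log t) (Ioc 0 σ) := by
    refine monotoneOn_of_hasDerivWithinAt_nonneg (convex_Ioc 0 σ)
      (fun s hs => (hd s hs).continuousAt.continuousWithinAt)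
      (fun s hs => (hd s (interior_subset hs)).hasDerivWithinAt) fun s hs => ?_
    have hs' := interior_subset hs
    have h1 := inv_anti₀ (hpos s (hsub hs')) (hK0 s (Ioc_subset_Icc_self hs'))
    rw [mul_inv] at h1
    linarith
  have hlim : Tendsto (fun t : ℝ => K⁻¹ * Real.log t) (𝓝[>] 0) atBot :=
    Real.tendsto_log_nhdsGT_zero.const_mul_atBot (inv_pos.2 hK)
  obtain ⟨t, ht1, ht2⟩ := ((hlim.eventually_lt_atBot
    (z - (T σ - K⁻¹ * Real.log σ))).and (Ioo_mem_nhdsGT hσ.1)).exists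
  have h1 := hmono (Ioo_subset_Ioc_self ht2) (right_mem_Ioc.2 hσ.1) ht2.2.le
  dsimp only at h1
  exact ⟨t, hsub (Ioo_subset_Ioc_self ht2), by linarith⟩

theorem le_profileOf {s z : ℝ} (hs : s ∈ Ioo (0 : ℝ) 1) (hsz : T s ≤ z) : s ≤ profileOf T z := by
  refine le_csSup ⟨1, ?_⟩ (mem_insert_of_mem _ ⟨hs, hsz⟩)
  rintro t (rfl | ht)
  · exact zero_le_one
  · exact ht.1.2.le

theorem profileOf_nonneg (z : ℝ) : 0 ≤ profileOf T z := by
  refine le_csSup ⟨1, ?_⟩ (mem_insert _ _)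
  rintro t (rfl | ht)
  · exact zero_le_one
  · exact ht.1.2.le

theorem profileOf_mono : Monotone (profileOf T) := by
  intro z₁ z₂ hz
  refine csSup_le ⟨0, mem_insert _ _⟩ ?_
  rintro t (rfl | ht)
  · exact profileOf_nonneg z₂
  · exact le_profileOf ht.1 (ht.2.trans hz)

theorem profileOf_le (hTm : StrictMonoOn T (Ioo 0 1)) {s z : ℝ} (hs : s ∈ Ioo (0 : ℝ) 1)
    (hsz : z ≤ T s) : profileOf T z ≤ s := by
  refine csSup_le ⟨0, mem_insert _ _⟩ ?_
  rintro t (rfl | ht)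
  · exact hs.1.le
  · exact (hTm.le_iff_le ht.1 hs).1 (ht.2.trans hsz)

theorem travel_time_profileOf (hTm : StrictMonoOn T (Ioo 0 1)) (hTc : ContinuousOn T (Ioo 0 1))
    {z : ℝ} (h0 : 0 < profileOf T z) (h1 : profileOf T z < 1) : T (profileOf T z) = z := by
  set s := profileOf T z with hs
  have hmem : s ∈ Ioo (0 : ℝ) 1 := ⟨h0, h1⟩
  have hcont : ContinuousAt T s := hTc.continuousAt (Ioo_mem_nhds h0 h1)
  rcases lt_trichotomy (T s) z with hlt | heq | hgt
  · obtain ⟨t, ht1, ht2, ht3⟩ := (((hcont.eventually_lt_const hlt).filter_mono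
      nhdsWithin_le_nhds).and (Ioo_mem_nhdsGT h1)).exists
    have := le_profileOf (T := T) (z := z) ⟨h0.trans ht2, ht3⟩ ht1.le
    rw [← hs] at this
    exact absurd ht2 this.not_gt
  · exact heq
  · obtain ⟨t, ht1, ht2, ht3⟩ := (((hcont.eventually_const_lt hgt).filter_mono
      nhdsWithin_le_nhds).and (Ioo_mem_nhdsLT h0)).exists
    have := profileOf_le hTm ⟨ht2, ht3.trans h1⟩ ht1.le
    rw [← hs] at this
    exact absurd ht3 this.not_gt

/-- The profile moves at most at the speed `η` as long as `h ≤ η` on the states it has visited. -/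
theorem profileOf_sub_le (hpos : ∀ s ∈ Ioo (0 : ℝ) 1, 0 < h s)
    (hT : ∀ s ∈ Ioo (0 : ℝ) 1, HasDerivAt T (h s)⁻¹ s) {η z₁ z₂ : ℝ} (hη : 0 < η)
    (hz : z₁ ≤ z₂) (h1 : profileOf T z₂ < 1) (hle : ∀ s ∈ Ioo 0 (profileOf T z₂), h s ≤ η) :
    profileOf T z₂ - profileOf T z₁ ≤ η * (z₂ - z₁) := by
  by_contra! hlt
  set s₂ := profileOf T z₂ with hs₂
  set s := s₂ - η * (z₂ - z₁) with hs
  have hηz : 0 ≤ η * (z₂ - z₁) := mul_nonneg hη.le (by linarith)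
  have hv1 : 0 ≤ profileOf T z₁ := profileOf_nonneg z₁
  have hs0 : 0 < s := by linarith
  have hss : s ≤ s₂ := by linarith
  have hTc : ContinuousOn T (Ioo 0 1) := fun t ht => (hT t ht).continuousAt.continuousWithinAt
  have hT2 : T s₂ = z₂ :=
    travel_time_profileOf (strictMonoOn_travel_time hpos hT) hTc (hs0.trans_le hss) h1
  have hsub : Ioc 0 s₂ ⊆ Ioo (0 : ℝ) 1 := fun t ht => ⟨ht.1, ht.2.trans_lt h1⟩
  have hd : ∀ t ∈ Ioc 0 s₂, HasDerivAt (fun t => T t - η⁻¹ * t) ((h t)⁻¹ - η⁻¹ * 1) t :=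
    fun t ht => (hT t (hsub ht)).sub ((hasDerivAt_id t).const_mul _)
  have hmono : MonotoneOn (fun t => T t - η⁻¹ * t) (Ioc 0 s₂) := by
    refine monotoneOn_of_hasDerivWithinAt_nonneg (convex_Ioc 0 s₂)
      (fun t ht => (hd t ht).continuousAt.continuousWithinAt)
      (fun t ht => (hd t (interior_subset ht)).hasDerivWithinAt) fun t ht => ?_
    rw [interior_Ioc] at ht
    have := inv_anti₀ (hpos t (hsub (Ioo_subset_Ioc_self ht))) (hle t ht)
    linarith
  have h2 := hmono ⟨hs0, hss⟩ ⟨hs0.trans_le hss, le_rfl⟩ hss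
  have h3 : η⁻¹ * s = η⁻¹ * s₂ - (z₂ - z₁) := by rw [hs]; field_simp
  simp only [hT2, h3] at h2
  have h4 := le_profileOf (T := T) (z := z₁) (hsub ⟨hs0, hss⟩) (by linarith)
  linarith

/-- If `h` is positive on `(0, 1)`, vanishes at `0` and vanishes at least linearly at `1`, the
equation `v' = h(v)` has a nondecreasing solution on `ℝ` that connects `0` to `1`. It may be equal to
`0` on a half-line, but not if `h` vanishes at least linearly at `0`. -/
theorem exists_profile (hc : ContinuousOn h (Icc 0 1)) (hpos : ∀ s ∈ Ioo (0 : ℝ) 1, 0 < h s)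
    (h0 : h 0 = 0) {K : ℝ} (hK : 0 < K) (hK1 : ∀ s ∈ Icc (0 : ℝ) 1, h s ≤ K * (1 - s)) :
    ∃ v : ℝ → ℝ, (∀ z, v z ∈ Ico (0 : ℝ) 1) ∧ (∀ z, HasDerivAt v (h (v z)) z) ∧
      Tendsto v atBot (𝓝 0) ∧ Tendsto v atTop (𝓝 1) ∧ Monotone v ∧
      ((∃ K' > 0, ∃ σ ∈ Ioo (0 : ℝ) 1, ∀ s ∈ Icc 0 σ, h s ≤ K' * s) → ∀ z, 0 < v z) := by
  obtain ⟨T, hT⟩ := exists_travel_time hc hpos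
  have hTm := strictMonoOn_travel_time hpos hT
  have hTc : ContinuousOn T (Ioo 0 1) := fun t ht => (hT t ht).continuousAt.continuousWithinAt
  have hlt1 : ∀ z, profileOf T z < 1 := fun z => by
    obtain ⟨s, hs, hsz⟩ := exists_lt_travel_time hpos hT hK hK1 z
    exact (profileOf_le hTm hs hsz.le).trans_lt hs.2
  have hhK : ∀ s ∈ Icc (0 : ℝ) 1, h s ≤ K := fun s hs =>
    (hK1 s hs).trans (mul_le_of_le_one_right hK.le (by linarith [hs.1]))
  have hcont : Continuous (profileOf T) := by
    refine (LipschitzWith.of_le_add_mul K.toNNReal fun z₁ z₂ => ?_).continuous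
    rw [Real.coe_toNNReal _ hK.le, Real.dist_eq]
    rcases le_total z₂ z₁ with hz | hz
    · have := profileOf_sub_le hpos hT hK hz (hlt1 _)
        fun s hs => hhK s ⟨hs.1.le, (hs.2.trans (hlt1 _)).le⟩
      rw [abs_of_nonneg (by linarith)]
      linarith
    · have h1 := profileOf_mono (T := T) hz
      have : 0 ≤ K * |z₁ - z₂| := by positivity
      linarith
  refine ⟨profileOf T, fun z => ⟨profileOf_nonneg z, hlt1 z⟩, fun z => ?_, ?_, ?_, profileOf_mono,
    ?_⟩
  · rcases (profileOf_nonneg (T := T) z).eq_or_lt with hz | hz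
    · rw [← hz, h0, hasDerivAt_iff_isLittleO, Asymptotics.isLittleO_iff]
      intro ε hε
      have hev : ∀ᶠ s in 𝓝[Icc 0 1] (0 : ℝ), h s < ε :=
        (hc 0 (by simp)).eventually_lt_const (by rwa [h0])
      obtain ⟨σ, hσ, hσ'⟩ := Metric.mem_nhdsWithin_iff.1 hev
      have hvσ : ∀ᶠ z' in 𝓝 z, profileOf T z' < σ :=
        hcont.continuousAt.eventually_lt_const (by rwa [← hz])
      filter_upwards [hvσ] with z' hz'
      rw [← hz, sub_zero, smul_zero, sub_zero, Real.norm_eq_abs, Real.norm_eq_abs,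
        abs_of_nonneg (profileOf_nonneg z')]
      rcases le_total z z' with hzz | hzz
      · have := profileOf_sub_le hpos hT hε hzz (hlt1 _) fun s hs => (hσ' ⟨?_, hs.1.le, ?_⟩).le
        · rwa [← hz, sub_zero, ← abs_of_nonneg (sub_nonneg.2 hzz)] at this
        · rw [Metric.mem_ball, Real.dist_eq, sub_zero, abs_of_pos hs.1]
          exact hs.2.trans hz'
        · exact (hs.2.trans (hlt1 _)).le
      · have h1 := profileOf_mono (T := T) hzz
        rw [← hz] at h1
        exact h1.trans (by positivity)
    · have hmem : profileOf T z ∈ Ioo (0 : ℝ) 1 := ⟨hz, hlt1 z⟩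
      have := HasDerivAt.of_local_left_inverse (g := profileOf T) (a := z) hcont.continuousAt
        (hT _ hmem) (inv_ne_zero (hpos _ hmem).ne') (by
          filter_upwards [hcont.continuousAt.eventually_const_lt hz] with z' hz'
          exact travel_time_profileOf hTm hTc hz' (hlt1 z'))
      rwa [inv_inv] at this
  · refine tendsto_order.2 ⟨fun a ha => Eventually.of_forall fun z =>
      ha.trans_le (profileOf_nonneg z), fun a ha => ?_⟩
    obtain ⟨s, hs0, hs1⟩ := exists_between (lt_min ha one_pos)
    have hs : s ∈ Ioo (0 : ℝ) 1 := ⟨hs0, hs1.trans_le (min_le_right _ _)⟩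
    filter_upwards [Iic_mem_atBot (T s)] with z hz
    exact (profileOf_le hTm hs hz).trans_lt (hs1.trans_le (min_le_left _ _))
  · refine tendsto_order.2 ⟨fun a ha => ?_, fun a ha => Eventually.of_forall fun z =>
      (hlt1 z).trans ha⟩
    obtain ⟨s, hs0, hs1⟩ := exists_between (max_lt ha one_pos)
    have hs : s ∈ Ioo (0 : ℝ) 1 := ⟨(le_max_right _ _).trans_lt hs0, hs1⟩
    filter_upwards [Ici_mem_atTop (T s)] with z hz
    exact ((le_max_left _ _).trans_lt hs0).trans_le (le_profileOf hs hz)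
  · rintro ⟨K', hK', σ, hσ, hle⟩ z
    obtain ⟨s, hs, hsz⟩ := exists_travel_time_lt hpos hT hK' hσ hle z
    exact hs.1.trans_le (le_profileOf hs hsz.le)

end Profile

/-! ### Fronts and phase curves -/

theorem pqFlux_self_of_nonneg {q s : ℝ} (hq : 1 < q) (hs : 0 ≤ s) :
    pqFlux q q s = 2 * s ^ (q - 1) := by
  rw [pqFlux_self, abs_of_nonneg hs]
  rcases hs.eq_or_lt with rfl | hs
  · rw [mul_zero, Real.zero_rpow (by linarith), mul_zero]
  · rw [mul_assoc, ← Real.rpow_add_one hs.ne']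
    congr 2; ring

theorem pqFlux_self_rpow {q q' s : ℝ} (hqq' : q.HolderConjugate q') (hs : 0 ≤ s) :
    pqFlux q q s ^ (q' - 1) = 2 ^ (q' - 1) * s := by
  rw [pqFlux_self_of_nonneg hqq'.lt hs, Real.mul_rpow zero_le_two (Real.rpow_nonneg hs _),
    rpow_sub_one_rpow_conj_sub_one hqq' hs]

theorem IsFisherReaction.nonneg {f : ℝ → ℝ} (hf : IsFisherReaction f) :
    ∀ s ∈ Icc (0 : ℝ) 1, 0 ≤ f s := by
  intro s hs
  rcases hs.1.eq_or_lt with rfl | h0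
  · exact hf.map_zero.ge
  rcases hs.2.eq_or_lt with rfl | h1
  · exact hf.map_one.ge
  · exact (hf.pos s ⟨h0, h1⟩).le

/-- A phase curve with `y(0) = 0` is the phase portrait of a front, which is obtained by solving
`v' = y(v)^(1/q) / 2^(q'-1)`. The front is strict if it needs an infinite time to leave `0`. -/
theorem IsPhaseCurve.exists_isMonotoneFront {q q' c k : ℝ} {f y : ℝ → ℝ}
    (h : IsPhaseCurve q q' c (fun s => 2 ^ (q' - 1) * f s) y) (hqq' : q.HolderConjugate q')
    (hq2 : 2 ≤ q) (hf : IsFisherReaction f) (hc : 0 < c) (hk : 0 < k)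
    (hfk : ∀ s ∈ Icc (0 : ℝ) 1, f s ≤ k * (1 - s)) (hy0 : y 0 = 0) :
    ∃ v, IsMonotoneFront q q f c v ∧
      ((∃ K > 0, ∃ σ ∈ Ioo (0 : ℝ) 1, ∀ s ∈ Icc 0 σ, y s ^ (1 / q) ≤ K * s) →
        IsStrictFront q q f c v) := by
  have hq := hqq'.pos
  have hq' := hqq'.symm.pos
  have h2 : (0 : ℝ) < 2 ^ (q' - 1) := Real.rpow_pos_of_pos two_pos _
  have hg : ∀ s ∈ Ioo (0 : ℝ) 1, 0 < 2 ^ (q' - 1) * f s := fun s hs => mul_pos h2 (hf.pos s hs)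
  have hyp : ∀ s ∈ Ioo (0 : ℝ) 1, 0 < y s := fun s hs => h.pos hq hq' hg hs
  obtain ⟨K, hK, hK1⟩ := h.exists_rpow_le_mul_one_sub hqq' hq2 hc (k := 2 ^ (q' - 1) * k)
    (mul_pos h2 hk) (fun s hs => by
      rw [mul_assoc]
      exact mul_le_mul_of_nonneg_left (hfk s (Ioo_subset_Icc_self hs)) h2.le)
  set H : ℝ → ℝ := fun s => y s ^ (1 / q) / 2 ^ (q' - 1) with hH
  have hHpos : ∀ s ∈ Ioo (0 : ℝ) 1, 0 < H s :=
    fun s hs => div_pos (Real.rpow_pos_of_pos (hyp s hs) _) h2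
  have hH0 : H 0 = 0 := by
    simp only [hH, hy0, Real.zero_rpow (one_div_ne_zero hq.ne'), zero_div]
  have hHnn : ∀ s ∈ Icc (0 : ℝ) 1, 0 ≤ H s :=
    fun s hs => div_nonneg (Real.rpow_nonneg (h.nonneg s hs) _) h2.le
  obtain ⟨v, hv, hvd, hbot, htop, hmono, hstrict⟩ := exists_profile (h := H)
    ((h.continuousOn.rpow_const fun _ _ => Or.inr hqq'.one_div_nonneg).div_const _) hHpos hH0
    (K := K / 2 ^ (q' - 1)) (div_pos hK h2) (fun s hs => by
      rw [div_mul_eq_mul_div]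
      exact div_le_div_of_nonneg_right (hK1 s hs) h2.le)
  have hvI : ∀ z, v z ∈ Icc (0 : ℝ) 1 := fun z => Ico_subset_Icc_self (hv z)
  have hflux : (fun z => pqFlux q q (deriv v z)) = fun z => y (v z) ^ (1 / q') := by
    funext z
    have hy := h.nonneg _ (hvI z)
    rw [(hvd z).deriv, pqFlux_self_of_nonneg hqq'.lt (hHnn _ (hvI z)), hH,
      Real.div_rpow (Real.rpow_nonneg hy _) h2.le, ← Real.rpow_mul hy, ← Real.rpow_mul zero_le_two]
    have e1 : (q' - 1) * (q - 1) = 1 := by linarith [hqq'.mul_eq_add]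
    have e2 : 1 / q * (q - 1) = 1 / q' := by
      rw [← sub_one_mul_one_div hqq'.symm]; ring
    rw [e1, e2, Real.rpow_one]
    ring
  have hfluxd : ∀ z, HasDerivAt (fun z => y (v z) ^ (1 / q')) (c * H (v z) - f (v z)) z := by
    intro z
    rcases (hv z).1.eq_or_lt with h0 | h0
    · -- At a point where `v = 0` the flux is `O(v)`, and `v' = H(0) = 0` there.
      rw [← h0, hH0, hf.map_zero, mul_zero, sub_zero, hasDerivAt_iff_isLittleO, ← h0, hy0,
        Real.zero_rpow (one_div_ne_zero hq'.ne')]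
      have hvo := hasDerivAt_iff_isLittleO.1 (hvd z)
      rw [← h0, hH0] at hvo
      simp only [smul_zero, sub_zero] at hvo ⊢
      refine (Asymptotics.IsBigO.of_bound c (Eventually.of_forall fun x => ?_)).trans_isLittleO hvo
      rw [Real.norm_eq_abs, Real.norm_eq_abs, abs_of_nonneg (hv x).1,
        abs_of_nonneg (Real.rpow_nonneg (h.nonneg _ (hvI x)) _)]
      exact h.flux_le hqq' hg hy0 _ (hvI x)
    · have hmem : v z ∈ Ioo (0 : ℝ) 1 := ⟨h0, (hv z).2⟩
      refine ((h.hasDerivAt_flux hqq' hmem (hyp _ hmem)).comp z (hvd z)).congr_deriv ?_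
      have : 0 < y (v z) ^ (1 / q) := Real.rpow_pos_of_pos (hyp _ hmem) _
      rw [hH]
      field_simp
  have hfront : IsMonotoneFront q q f c v :=
    { differentiable := fun z => (hvd z).differentiableAt
      differentiable_flux := by
        rw [hflux]; exact fun z => (hfluxd z).differentiableAt
      equation := fun z => by
        rw [hflux, (hfluxd z).deriv, (hvd z).deriv]; ring
      tendsto_atBot := hbot
      tendsto_atTop := htop
      monotone := hmono }
  refine ⟨v, hfront, ?_⟩
  rintro ⟨K', hK', σ, hσ, hle⟩
  have hvpos := hstrict ⟨K' / 2 ^ (q' - 1), div_pos hK' h2, σ, hσ, fun s hs => by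
    rw [div_mul_eq_mul_div]
    exact div_le_div_of_nonneg_right (hle s hs) h2.le⟩
  exact { hfront with
    deriv_pos := fun z => by
      rw [(hvd z).deriv]
      exact hHpos _ ⟨hvpos z, (hv z).2⟩ }

namespace IsMonotoneFront

variable {p q q' c : ℝ} {f v : ℝ → ℝ}

theorem mem_Icc (h : IsMonotoneFront p q f c v) (z : ℝ) : v z ∈ Icc (0 : ℝ) 1 :=
  ⟨h.monotone.le_of_tendsto h.tendsto_atBot z, h.monotone.ge_of_tendsto h.tendsto_atTop z⟩

theorem deriv_nonneg (h : IsMonotoneFront p q f c v) (z : ℝ) : 0 ≤ deriv v z :=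
  h.monotone.deriv_nonneg

theorem exists_deriv_lt (h : IsMonotoneFront p q f c v) (a : ℝ) {δ : ℝ} (hδ : 0 < δ) :
    ∃ z ∈ Ioo a (a + 2 / δ), deriv v z < δ := by
  have hab : a < a + 2 / δ := by linarith [div_pos two_pos hδ]
  obtain ⟨z, hz, hz'⟩ := exists_deriv_eq_slope v hab h.differentiable.continuous.continuousOn
    h.differentiable.differentiableOn
  refine ⟨z, hz, ?_⟩
  rw [hz', add_sub_cancel_left, div_lt_iff₀ (by positivity), mul_div_cancel₀ _ hδ.ne']
  linarith [(h.mem_Icc a).1, (h.mem_Icc (a + 2 / δ)).2]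

theorem exists_seq_atTop (h : IsMonotoneFront p q f c v) :
    ∃ z : ℕ → ℝ, Tendsto z atTop atTop ∧ Tendsto (fun n => deriv v (z n)) atTop (𝓝 0) := by
  choose z hz hzd using fun n : ℕ => h.exists_deriv_lt n (Nat.one_div_pos_of_nat (n := n) (α := ℝ))
  exact ⟨z, tendsto_atTop_mono (fun n => (hz n).1.le) tendsto_natCast_atTop_atTop,
    squeeze_zero (fun n => h.deriv_nonneg _) (fun n => (hzd n).le)
      tendsto_one_div_add_atTop_nhds_zero_nat⟩

theorem exists_seq_atBot (h : IsMonotoneFront p q f c v) :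
    ∃ z : ℕ → ℝ, Tendsto z atTop atBot ∧ Tendsto (fun n => deriv v (z n)) atTop (𝓝 0) := by
  choose z hz hzd using fun n : ℕ => h.exists_deriv_lt (-(n : ℝ) - 2 / (1 / ((n : ℝ) + 1)))
    (Nat.one_div_pos_of_nat (n := n) (α := ℝ))
  refine ⟨z, tendsto_atBot_mono (fun n => ?_)
    (tendsto_neg_atTop_atBot.comp tendsto_natCast_atTop_atTop),
    squeeze_zero (fun n => h.deriv_nonneg _) (fun n => (hzd n).le)
      tendsto_one_div_add_atTop_nhds_zero_nat⟩
  have := (hz n).2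
  rw [sub_add_cancel] at this
  exact this.le

/-- Fronts have positive speed: for `c ≤ 0` the flux would be nonincreasing, while it is nonnegative
and takes arbitrarily small values near `-∞`. -/
theorem speed_pos (h : IsMonotoneFront q q f c v) (hq : 1 < q)
    (hf : ∀ s ∈ Icc (0 : ℝ) 1, 0 ≤ f s) : 0 < c := by
  by_contra! hc
  have hanti : Antitone fun z => pqFlux q q (deriv v z) := by
    refine antitone_of_deriv_nonpos h.differentiable_flux fun z => ?_
    have h1 := h.equation z
    have h2 := hf _ (h.mem_Icc z)
    have h3 := mul_nonpos_of_nonpos_of_nonneg hc (h.deriv_nonneg z)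
    linarith
  have hzero : ∀ z, deriv v z = 0 := by
    intro z
    by_contra hne
    have hpos : 0 < deriv v z := (h.deriv_nonneg z).lt_of_ne' hne
    obtain ⟨x, hx, hxd⟩ := h.exists_deriv_lt (z - 2 / deriv v z) hpos
    rw [sub_add_cancel] at hx
    have h1 := hanti hx.2.le
    simp only [pqFlux_self_of_nonneg hq (h.deriv_nonneg _)] at h1
    have h2 := Real.rpow_lt_rpow (h.deriv_nonneg x) hxd (by linarith : 0 < q - 1)
    linarith
  have hconst : ∀ z, v z = v 0 := fun z => is_const_of_deriv_eq_zero h.differentiable hzero z 0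
  have h0 : v 0 = 0 := tendsto_nhds_unique
    (tendsto_const_nhds.congr fun z => (hconst z).symm) h.tendsto_atBot
  have h1 : v 0 = 1 := tendsto_nhds_unique
    (tendsto_const_nhds.congr fun z => (hconst z).symm) h.tendsto_atTop
  linarith

/-- Along a front of speed `c`, the phase curve of speed `c` is the power `q'` of the flux: the
square of the difference is nondecreasing and takes arbitrarily small values near `+∞`. Letting
`z → -∞`, the phase curve vanishes at `0`. -/
theorem phaseCurve_zero (h : IsMonotoneFront q q f c v) (hqq' : q.HolderConjugate q')
    (hc : 0 ≤ c) {y : ℝ → ℝ} (hy : IsPhaseCurve q q' c (fun s => 2 ^ (q' - 1) * f s) y) :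
    y 0 = 0 := by
  have hq := hqq'.pos
  have hq' := hqq'.symm.pos
  set W : ℝ → ℝ := fun z => pqFlux q q (deriv v z) with hW
  have hW0 : ∀ z, 0 ≤ W z := fun z => by
    rw [hW]; dsimp only
    rw [pqFlux_self_of_nonneg hqq'.lt (h.deriv_nonneg z)]
    exact mul_nonneg zero_le_two (Real.rpow_nonneg (h.deriv_nonneg z) _)
  have hWr : ∀ z, W z ^ (q' - 1) = 2 ^ (q' - 1) * deriv v z := fun z =>
    pqFlux_self_rpow hqq' (h.deriv_nonneg z)
  have hWd : ∀ z, HasDerivAt W (c * deriv v z - f (v z)) z := fun z =>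
    (h.differentiable_flux z).hasDerivAt.congr_deriv (by linarith [h.equation z])
  have hDd : ∀ z, HasDerivAt (fun z => W z ^ q' - y (v z))
      (q' * c * deriv v z * (W z ^ (q' - 1) - y (v z) ^ (1 / q))) z := by
    intro z
    have h1 := (hWd z).rpow_const (p := q') (Or.inr hqq'.symm.lt.le)
    have h2 := (hy.hasDerivWithinAt _ (h.mem_Icc z)).comp_hasDerivAt z
      (h.differentiable z).hasDerivAt (Eventually.of_forall h.mem_Icc)
    refine (h1.sub h2).congr_deriv ?_
    simp only [hWr]
    ring
  have hmono : Monotone fun z => (W z ^ q' - y (v z)) ^ 2 := by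
    refine monotone_of_hasDerivAt_nonneg (fun z => (hDd z).pow 2) fun z => ?_
    have hpow : (W z ^ q') ^ (1 / q) = W z ^ (q' - 1) := rpow_conj_rpow_one_div hqq' (hW0 z)
    have hu := mul_nonneg (mul_nonneg hq'.le hc) (h.deriv_nonneg z)
    have hsign : 0 ≤ (W z ^ q' - y (v z)) * (W z ^ (q' - 1) - y (v z) ^ (1 / q)) := by
      rw [← hpow]
      rcases le_total (y (v z)) (W z ^ q') with hle | hle
      · exact mul_nonneg (sub_nonneg.2 hle) (sub_nonneg.2
          (Real.rpow_le_rpow (hy.nonneg _ (h.mem_Icc z)) hle hqq'.one_div_nonneg))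
      · exact mul_nonneg_of_nonpos_of_nonpos (sub_nonpos.2 hle) (sub_nonpos.2
          (Real.rpow_le_rpow (Real.rpow_nonneg (hW0 z) _) hle hqq'.one_div_nonneg))
    have := mul_nonneg hu hsign
    simp only [Pi.zero_apply, Nat.cast_ofNat, Nat.add_one_sub_one, pow_one]
    linarith
  have hWlim : ∀ z : ℕ → ℝ, Tendsto (fun n => deriv v (z n)) atTop (𝓝 0) →
      Tendsto (fun n => W (z n) ^ q') atTop (𝓝 0) := by
    intro z hz
    have h1 : ∀ n, W (z n) ^ q' = (2 * deriv v (z n) ^ (q - 1)) ^ q' := fun n => by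
      rw [hW]; dsimp only
      rw [pqFlux_self_of_nonneg hqq'.lt (h.deriv_nonneg _)]
    simp only [h1]
    have h2 := ((hz.rpow_const (Or.inr hqq'.sub_one_pos.le)).const_mul 2).rpow_const
      (p := q') (Or.inr hq'.le)
    rwa [Real.zero_rpow hqq'.sub_one_pos.ne', mul_zero, Real.zero_rpow hq'.ne'] at h2
  have hylim : ∀ (s : ℝ) (z : ℕ → ℝ), s ∈ Icc (0 : ℝ) 1 →
      Tendsto (fun n => v (z n)) atTop (𝓝 s) → Tendsto (fun n => y (v (z n))) atTop (𝓝 (y s)) :=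
    fun s z hs hz => (hy.continuousOn s hs).tendsto.comp
      (tendsto_nhdsWithin_iff.2 ⟨hz, Eventually.of_forall fun n => h.mem_Icc _⟩)
  have hzero : ∀ x, W x ^ q' - y (v x) = 0 := by
    intro x
    obtain ⟨z, hz, hzd⟩ := h.exists_seq_atTop
    have h1 := ((hWlim z hzd).sub
      (hylim 1 z (by simp) (h.tendsto_atTop.comp hz))).pow 2
    rw [hy.map_one, sub_zero, zero_pow two_ne_zero] at h1
    have h2 : (W x ^ q' - y (v x)) ^ 2 ≤ 0 :=
      ge_of_tendsto h1 ((hz.eventually_ge_atTop x).mono fun n hn => hmono hn)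
    exact pow_eq_zero_iff two_ne_zero |>.1 (le_antisymm h2 (sq_nonneg _))
  obtain ⟨z, hz, hzd⟩ := h.exists_seq_atBot
  refine tendsto_nhds_unique (hylim 0 z (by simp) (h.tendsto_atBot.comp hz)) ?_
  exact (hWlim z hzd).congr fun n => sub_eq_zero.1 (hzero _)

end IsMonotoneFront

/-! ### The critical speed -/

theorem IsPhaseCurve.exists_rpow_le_mul_of_two_or_lt {q q' c M : ℝ} {g y : ℝ → ℝ}
    (h : IsPhaseCurve q q' c g y) (hqq' : q.HolderConjugate q') (hq2 : 2 ≤ q) (hc : 0 < c)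
    (hg : ∀ s ∈ Ioo (0 : ℝ) 1, 0 < g s) (hgM : ∀ s ∈ Ioo (0 : ℝ) 1, g s ≤ M * s) (hy0 : y 0 = 0)
    (ha : q = 2 ∨ ∃ a, 0 < a ∧ a < c ∧ ∀ s ∈ Icc (0 : ℝ) 1, y s ≤ (a * s) ^ q') :
    ∃ K > 0, ∃ σ ∈ Ioo (0 : ℝ) 1, ∀ s ∈ Icc 0 σ, y s ^ (1 / q) ≤ K * s := by
  rcases hq2.eq_or_lt with rfl | hq2
  · have hq' : q' = 2 := by linarith [hqq'.mul_eq_add]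
    refine ⟨c, hc, 1 / 2, by norm_num, fun s hs => ?_⟩
    have := h.flux_le hqq' hg hy0 s ⟨hs.1, by linarith [hs.2]⟩
    rwa [hq'] at this
  · obtain ⟨a, ha0, hac, hya⟩ := ha.resolve_left hq2.ne'
    exact h.exists_rpow_le_mul hqq' hq2 ha0 hac hgM hya

/-- The set of speeds whose phase curve reaches `0` at `s = 0` is a closed half-line
`[cs, ∞)` with `cs > 0`, provided that it contains some positive speed. -/
theorem exists_critical_speed {q q' C : ℝ} {g : ℝ → ℝ} {y : ℝ → ℝ → ℝ}
    (hqq' : q.HolderConjugate q') (hg : ∀ s ∈ Ioo (0 : ℝ) 1, 0 < g s)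
    (hy : ∀ c, 0 ≤ c → IsPhaseCurve q q' c g (y c)) (hC : 0 ≤ C) (hyC : y C 0 = 0) :
    ∃ cs, 0 < cs ∧ cs ≤ C ∧ ∀ c, 0 ≤ c → (y c 0 = 0 ↔ cs ≤ c) := by
  have hq := hqq'.pos
  have hq' := hqq'.symm.pos
  have h0I : (0 : ℝ) ∈ Icc (0 : ℝ) 1 := by simp
  set A : Set ℝ := {c | 0 ≤ c ∧ y c 0 = 0} with hA
  have hne : A.Nonempty := ⟨C, hC, hyC⟩
  have hbdd : BddBelow A := ⟨0, fun c hc => hc.1⟩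
  have hup : ∀ c ∈ A, ∀ c', c ≤ c' → y c' 0 = 0 := fun c hc c' hcc' =>
    le_antisymm (((hy c' (hc.1.trans hcc')).le_of_speed_le (hy c hc.1) hq hq' hc.1 hcc' 0
      h0I).trans hc.2.le) ((hy c' (hc.1.trans hcc')).nonneg 0 h0I)
  set cs := sInf A
  have hcs0 : 0 ≤ cs := le_csInf hne fun c hc => hc.1
  have hcsA : y cs 0 = 0 := by
    refine le_antisymm ?_ ((hy cs hcs0).nonneg 0 h0I)
    obtain ⟨N, hN⟩ := isCompact_Icc.exists_bound_of_continuousOn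
      ((hy cs hcs0).continuousOn.rpow_const (p := 1 / q) fun _ _ => Or.inr hqq'.one_div_nonneg)
    have hN0 : 0 ≤ N := (norm_nonneg _).trans (hN 0 h0I)
    obtain ⟨u, -, hulim, huA⟩ := exists_seq_tendsto_sInf hne hbdd
    have hle : ∀ n, y cs 0 ≤ q' * ((u n - cs) * N) := fun n => by
      have hcn : cs ≤ u n := csInf_le hbdd (huA n)
      have := (hy cs hcs0).le_add_mul (hy (u n) (huA n).1) hq hq' hcs0
        (mul_nonneg (sub_nonneg.2 hcn) hN0) (fun s hs =>
          mul_le_mul_of_nonneg_left ((Real.rpow_le_rpow ((hy _ (huA n).1).nonneg s hs)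
            ((hy _ (huA n).1).le_of_speed_le (hy cs hcs0) hq hq' hcs0 hcn s hs)
            hqq'.one_div_nonneg).trans ((le_abs_self _).trans (hN s hs))) (sub_nonneg.2 hcn)) 0 h0I
      rwa [(huA n).2, zero_add, sub_zero, mul_one] at this
    have hlim : Tendsto (fun n => q' * ((u n - cs) * N)) atTop (𝓝 0) := by
      have := ((hulim.sub_const cs).mul_const N).const_mul q'
      rwa [sub_self, zero_mul, mul_zero] at this
    exact ge_of_tendsto hlim (Eventually.of_forall hle)
  refine ⟨cs, hcs0.lt_of_ne fun h0 => ?_, csInf_le hbdd ⟨hC, hyC⟩, fun c hc => ⟨fun h =>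
    csInf_le hbdd ⟨hc, h⟩, hup cs ⟨hcs0, hcsA⟩ c⟩⟩
  have hhalf : (1 / 2 : ℝ) ∈ Ioo (0 : ℝ) 1 := by norm_num
  have h1 := (hy cs hcs0).flux_le hqq' hg hcsA (1 / 2) (Ioo_subset_Icc_self hhalf)
  rw [← h0, zero_mul] at h1
  rw [← h0] at hcs0
  exact h1.not_gt (Real.rpow_pos_of_pos ((hy 0 hcs0).pos hq hq' hg hhalf) _)

theorem speedBound_le_of_forall_lt {q q' L c : ℝ} (hqq' : q.HolderConjugate q') (hL : 0 ≤ L)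
    (hc : 0 ≤ c) (h : ∀ l, 0 < l → l < L → speedBound q q' l ≤ c) : speedBound q q' L ≤ c := by
  rcases hL.eq_or_lt with rfl | hL
  · rw [speedBound, Real.zero_rpow (one_div_ne_zero hqq'.symm.ne_zero)]
    simpa using hc
  · have hcont : Continuous (speedBound q q') := by
      unfold speedBound
      exact ((continuous_const.mul (Real.continuous_rpow_const hqq'.symm.one_div_nonneg)).mul
        continuous_const).mul continuous_const
    refine le_of_tendsto (hcont.continuousAt.tendsto.mono_left (nhdsWithin_le_nhds (s := Iio L))) ?_
    filter_upwards [Ioo_mem_nhdsLT hL] with l hl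
    exact h l hl.1 hl.2

theorem corollary2p4 (q q' : ℝ) (hq : 2 ≤ q) (hqq' : q.HolderConjugate q')
    (f : ℝ → ℝ) (hf : IsFisherReaction f) (L₀ Lp : ℝ)
    (hL₀ : Tendsto (fun s => f s / s ^ (q' - 1)) (𝓝[>] 0) (𝓝 L₀))
    (hLp : IsLUB ((fun s => f s / s ^ (q' - 1)) '' Ioc 0 1) Lp)
    (hk : ∃ k > 0, ∀ s ∈ Icc (0 : ℝ) 1, f s ≤ k * (1 - s)) :
    ∃ cs : ℝ,
      speedBound q q' L₀ ≤ cs ∧ cs ≤ speedBound q q' Lp ∧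
      (∀ c, IsAdmissible q q f c ↔ cs ≤ c) ∧
      (∀ c, cs < c → IsStrictlyAdmissible q q f c) ∧
      (q = 2 → IsStrictlyAdmissible q q f cs) ∧
      IsStrictlyAdmissible q q f (speedBound q q' Lp) ∧
      (L₀ = Lp → cs = speedBound q q' L₀) := by
  obtain ⟨k, hk, hfk⟩ := hk
  have hq0 := hqq'.pos
  have hq0' := hqq'.symm.pos
  have h2 : (0 : ℝ) < 2 ^ (q' - 1) := Real.rpow_pos_of_pos two_pos _
  have hhalf : (1 / 2 : ℝ) ∈ Ioo (0 : ℝ) 1 := by norm_num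
  have hg : ∀ s ∈ Ioo (0 : ℝ) 1, 0 < 2 ^ (q' - 1) * f s := fun s hs => mul_pos h2 (hf.pos s hs)
  have hfp : ∀ s ∈ Ioc (0 : ℝ) 1, f s ≤ Lp * s ^ (q' - 1) := fun s hs =>
    (div_le_iff₀ (Real.rpow_pos_of_pos hs.1 _)).1 (hLp.1 (mem_image_of_mem _ hs))
  have hLp0 : 0 < Lp := (div_pos (hf.pos _ hhalf) (Real.rpow_pos_of_pos hhalf.1 _)).trans_le
    (hLp.1 (mem_image_of_mem _ (Ioo_subset_Ioc_self hhalf)))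
  have hL00 : 0 ≤ L₀ := by
    refine ge_of_tendsto hL₀ ?_
    filter_upwards [Ioo_mem_nhdsGT (zero_lt_one (α := ℝ))] with s hs
    exact div_nonneg (hf.pos s hs).le (Real.rpow_nonneg hs.1.le _)
  obtain ⟨M, hM⟩ := hf.contDiffOn.exists_lipschitzOnWith one_ne_zero (convex_Icc 0 1) isCompact_Icc
  have hgM : ∀ s ∈ Ioo (0 : ℝ) 1, 2 ^ (q' - 1) * f s ≤ 2 ^ (q' - 1) * M * s := fun s hs => by
    have := hM.dist_le_mul s (Ioo_subset_Icc_self hs) 0 (by simp)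
    rw [Real.dist_eq, Real.dist_eq, hf.map_zero, sub_zero, sub_zero, abs_of_pos hs.1] at this
    rw [mul_assoc]
    exact mul_le_mul_of_nonneg_left ((le_abs_self _).trans this) h2.le
  choose! y hy using fun (c : ℝ) (hc : 0 ≤ c) =>
    exists_isPhaseCurve (q := q) (g := fun s => 2 ^ (q' - 1) * f s) hq0 hq0' hc
      (continuousOn_const.mul hf.contDiffOn.continuousOn)
      (fun s hs => mul_nonneg h2.le (hf.nonneg s hs))
  set C := speedBound q q' Lp with hC
  have hC0 : 0 < C := speedBound_pos hqq' hLp0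
  have hylin : ∀ s ∈ Icc (0 : ℝ) 1, y C s ≤ (C / q * s) ^ q' :=
    (hy C hC0.le).le_linear_of_speedBound hqq' hLp0.le fun s hs => by
      rw [mul_assoc]
      exact mul_le_mul_of_nonneg_left (hfp s (Ioo_subset_Ioc_self hs)) h2.le
  have hyC : y C 0 = 0 := by
    refine le_antisymm ?_ ((hy C hC0.le).nonneg 0 (by simp))
    have := hylin 0 (by simp)
    rwa [mul_zero, Real.zero_rpow hq0'.ne'] at this
  obtain ⟨cs, hcs0, hcsC, hcs⟩ := exists_critical_speed hqq' hg hy hC0.le hyC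
  have hycs : y cs 0 = 0 := (hcs cs hcs0.le).2 le_rfl
  have hstrict : ∀ c, cs ≤ c →
      (q = 2 ∨ ∃ a, 0 < a ∧ a < c ∧ ∀ s ∈ Icc (0 : ℝ) 1, y c s ≤ (a * s) ^ q') →
      IsStrictlyAdmissible q q f c := fun c hc ha => by
    have hc0 := hcs0.trans_le hc
    have hyc := (hcs c hc0.le).2 hc
    obtain ⟨v, -, hv⟩ := (hy c hc0.le).exists_isMonotoneFront hqq' hq hf hc0 hk hfk hyc
    exact ⟨v, hv ((hy c hc0.le).exists_rpow_le_mul_of_two_or_lt hqq' hq hc0 hg hgM hyc ha)⟩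
  have hlower : speedBound q q' L₀ ≤ cs := by
    refine speedBound_le_of_forall_lt hqq' hL00 hcs0.le fun l hl0 hl => ?_
    obtain ⟨σ, hσ, hσl⟩ := mem_nhdsGT_iff_exists_Ioo_subset.1
      ((hL₀.eventually_const_lt hl).and (Ioo_mem_nhdsGT (zero_lt_one (α := ℝ))))
    refine (hy cs hcs0.le).speedBound_le hqq' hg hycs hl0.le (lt_min hσ one_pos)
      (min_le_right σ 1) fun s hs => ?_
    have h1 := (hσl ⟨hs.1, hs.2.trans_le (min_le_left _ _)⟩).1
    rw [mul_assoc]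
    exact mul_le_mul_of_nonneg_left
      ((lt_div_iff₀ (Real.rpow_pos_of_pos hs.1 _)).1 h1).le h2.le
  refine ⟨cs, hlower, hcsC, fun c => ⟨?_, fun hc => ?_⟩, fun c hc => ?_, fun h => ?_, ?_, ?_⟩
  · rintro ⟨v, hv⟩
    have hc0 := hv.speed_pos hqq'.lt hf.nonneg
    exact (hcs c hc0.le).1 (hv.phaseCurve_zero hqq' hc0.le (hy c hc0.le))
  · have hc0 := hcs0.trans_le hc
    obtain ⟨v, hv, -⟩ := (hy c hc0.le).exists_isMonotoneFront hqq' hq hf hc0 hk hfk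
      ((hcs c hc0.le).2 hc)
    exact ⟨v, hv⟩
  · -- Above the critical speed, `y c ≤ y cs ≤ (cs s)^q'` and `cs < c`.
    refine hstrict c hc.le (Or.inr ⟨cs, hcs0, hc, fun s hs => ?_⟩)
    exact ((hy c (hcs0.trans hc).le).le_of_speed_le (hy cs hcs0.le) hq0 hq0' hcs0.le hc.le s
      hs).trans ((hy cs hcs0.le).le_rpow_of_flux_le hqq' hs
        ((hy cs hcs0.le).flux_le hqq' hg hycs s hs))
  · exact hstrict cs le_rfl (Or.inl h)
  · exact hstrict C hcsC (Or.inr ⟨C / q, by positivity, div_lt_self hC0 hqq'.lt, hylin⟩)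
  · rintro rfl
    exact le_antisymm hcsC hlower
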